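/- Let $A,B\in M_n(\mathbb Z)$ be non-singular with characteristic polynomials $h_A,h_B$. Let $G_A=\{A^{-k}x : x\in\mathbb Z^n,\ k\in\mathbb Z\}\subseteq\mathbb Q^n$, define $G_B$ likewise, and let $T\in GL_n(\mathbb Q)$ be an isomorphism from $G_A$ to $G_B$, i.e. $T(G_A)=G_B$. Call $T$ *reducible* if there are $S_0,L_0\in GL_n(\mathbb Z)$ and non-constant $f,g,f',g'\in\mathbb Z[t]$ with $h_A=fg$, $h_B=f'g'$, $\deg f=\deg f'=m$, $$S_0AS_0^{-1}=\begin{pmatrix}A'&*\\0&A''\end{pmatrix},\qquad L_0BL_0^{-1}=\begin{pmatrix}B'&*\\0&B''\end{pmatrix},$$ where $A',B'\in M_m(\mathbb Z)$ have characteristic polynomials $f,f'$, such that $L_0TS_0^{-1}$ maps $G_{A'}$ onto $G_{B'}$, both embedded in $\mathbb Q^n$ by $x\mapsto(x,0)$. Otherwise $T$ is *irreducible*. Write $h_A=h_1^{\alpha_1}\cdots h_k^{\alpha_k}$ and $h_B=r_1^{\beta_1}\cdots r_s^{\beta_s}$ with $h_1,\dots,h_k$ (resp. $r_1,\dots,r_s$)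 distinct monic irreducible polynomials in $\mathbb Z[t]$ and all $\alpha_i,\beta_j\ge1$. Let $K$ be a finite Galois extension of $\mathbb Q$ containing all eigenvalues of $A$ and $B$, let $\Sigma,\Sigma'\subset K$ be the sets of distinct eigenvalues of $A$ and $B$, let $\Sigma_i$ (resp. $\Sigma'_j$) be the set of roots of $h_i$ (resp. $r_j$), and put $n_i(A)=|\Sigma_i|$, $n_j(B)=|\Sigma'_j|$. For $M\subseteq\Sigma$ let $M_i=M\cap\Sigma_i$, let $\|M\|=\sum_i\alpha_i|M_i|$, and let $U_M\subseteq K^n$ be the sum of the generalized $\lambda$-eigenspaces of $A$ over $\lambda\in M$. For $M'\subseteq\Sigma'$ define $M'_j=M'\cap\Sigma'_j$, $\|M'\|=\sum_j\beta_j|M'_j|$ and $V_{M'}$ likewise with $B$ in place of $A$. For a prime $p$ let $t_p(A)$, $t_{p,i}(A)$, $t_p(B)$, $t_{p,j}(B)$ be the multiplicity of zero as a root of the reduction modulo $p$ of $h_A$, $h_i$, $h_B$, $r_j$, respectively. Let $\mathcal P'(A)$ be the set of primes $p$ with $p\mid\det A$ and $h_A\not\equiv t^n\pmod p$, and define $\mathcal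 P'(B)$ likewise. Suppose $T$ is irreducible. Let $S\subseteq\Sigma$ be a non-empty set of the smallest cardinality among those for which there is $S'\subseteq\Sigma'$ with $T(U_S)=V_{S'}$, and let $S'$ be such a set for $S$. Then $S_i\ne\emptyset$ and $S'_j\ne\emptyset$ for all $i,j$, and $\|S\|=\|S'\|$. Moreover $\mathcal P'(A)=\mathcal P'(B)=:\mathcal P'$, $t_p(A)=t_p(B)=:t_p$ for all $p\in\mathcal P'$, and for all $i$ and all $p\in\mathcal P'$: (a) $\|S\|$ divides $n$ and $t_p$; (b) $|S_i|$ divides $n_i(A)$ and $t_{p,i}(A)$; (c) $\dfrac{n_i(A)}{|S_i|}=\dfrac{n}{\|S\|}$; (d) $\dfrac{t_{p,i}(A)}{|S_i|}=\dfrac{t_p}{\|S\|}$. Likewise for $B$: for all $j$ and all $p\in\mathcal P'$, $\|S'\|$ divides $n$ and $t_p$, $|S'_j|$ divides $n_j(B)$ and $t_{p,j}(B)$, $\dfrac{n_j(B)}{|S'_j|}=\dfrac{n}{\|S'\|}$ and $\dfrac{t_{p,j}(B)}{|S'_j|}=\dfrac{t_p}{\|S'\|}$. The assertions that do not mention $p$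 hold also if $\mathcal P'$ is empty. -/

import Mathlib

open Polynomial Matrix

namespace Solenoid

/-- The set `G_A = {A⁻ᵏ x : x ∈ ℤⁿ, k ∈ ℤ} ⊆ ℚⁿ` of an integer matrix `A`
(a subgroup of `ℚⁿ` if `A` is non-singular). -/
def groupSet {n : ℕ} (A : Matrix (Fin n) (Fin n) ℤ) : Set (Fin n → ℚ) :=
  {v | ∃ (k : ℤ) (x : Fin n → ℤ),
    v = ((A.map (Int.cast : ℤ → ℚ)) ^ (-k)) *ᵥ (fun i => (x i : ℚ))}

/-- `T ∈ GL_n(ℚ)` is an isomorphism from `G_A` to `G_B`: `T(G_A) = G_B`. -/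
def IsIso {n : ℕ} (A B : Matrix (Fin n) (Fin n) ℤ) (T : GL (Fin n) ℚ) : Prop :=
  (fun v => (T : Matrix (Fin n) (Fin n) ℚ) *ᵥ v) '' groupSet A = groupSet B

/-- The identification of the index set of a `(m, l)`-block vector with `Fin n`, `m + l = n`
(the first `m` indices come first). -/
def blockIndex {m l n : ℕ} (h : m + l = n) : Fin m ⊕ Fin l ≃ Fin n :=
  finSumFinEquiv.trans (finCongr h)

/-- The block upper triangular matrix with diagonal blocks `A'`, `A''` and upper right
block `C`. -/
def blockUpper {m l n : ℕ} (h : m + l = n) (A' : Matrix (Fin m) (Fin m) ℤ)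
    (C : Matrix (Fin m) (Fin l) ℤ) (A'' : Matrix (Fin l) (Fin l) ℤ) :
    Matrix (Fin n) (Fin n) ℤ :=
  Matrix.reindex (blockIndex h) (blockIndex h) (Matrix.fromBlocks A' C 0 A'')

/-- The embedding `x ↦ (x, 0)` of `ℚᵐ` into `ℚⁿ`, `m + l = n`. -/
def blockEmb {m l n : ℕ} (h : m + l = n) (x : Fin m → ℚ) : Fin n → ℚ :=
  fun i => Sum.elim x (fun _ => 0) ((blockIndex h).symm i)

/-- The isomorphism `T : G_A → G_B` is reducible: there are `S, L ∈ GL_n(ℤ)` and non-constant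
`f, g, f', g' ∈ ℤ[t]` with `h_A = f g`, `h_B = f' g'`, such that `S A S⁻¹` and `L B L⁻¹` are
block upper triangular with first diagonal blocks `A'`, `B'` of characteristic polynomials
`f`, `f'` of the same degree (the common size `m` of `A'` and `B'`),
and `L T S⁻¹` maps `G_f = G_{A'}` onto `G_{f'} = G_{B'}`, both embedded by `x ↦ (x, 0)`. -/
def IsReducible {n : ℕ} (A B : Matrix (Fin n) (Fin n) ℤ) (T : GL (Fin n) ℚ) : Prop :=
  ∃ (S L : GL (Fin n) ℤ) (f g f' g' : ℤ[X]),
    f.natDegree ≠ 0 ∧ g.natDegree ≠ 0 ∧ f'.natDegree ≠ 0 ∧ g'.natDegree ≠ 0 ∧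
    A.charpoly = f * g ∧ B.charpoly = f' * g' ∧
    ∃ (m l : ℕ) (h : m + l = n) (A' B' : Matrix (Fin m) (Fin m) ℤ)
      (C D : Matrix (Fin m) (Fin l) ℤ) (A'' B'' : Matrix (Fin l) (Fin l) ℤ),
      (S : Matrix (Fin n) (Fin n) ℤ) * A * ((S⁻¹ : GL (Fin n) ℤ) : Matrix (Fin n) (Fin n) ℤ)
        = blockUpper h A' C A'' ∧
      (L : Matrix (Fin n) (Fin n) ℤ) * B * ((L⁻¹ : GL (Fin n) ℤ) : Matrix (Fin n) (Fin n) ℤ)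
        = blockUpper h B' D B'' ∧
      A'.charpoly = f ∧ B'.charpoly = f' ∧
      (fun v => ((L : Matrix (Fin n) (Fin n) ℤ).map (Int.cast : ℤ → ℚ)
          * (T : Matrix (Fin n) (Fin n) ℚ)
          * ((S⁻¹ : GL (Fin n) ℤ) : Matrix (Fin n) (Fin n) ℤ).map (Int.cast : ℤ → ℚ)) *ᵥ v)
        '' (blockEmb h '' groupSet A') = blockEmb h '' groupSet B'

/-- `T` is an irreducible isomorphism from `G_A` to `G_B`. -/
def IsIrreducibleIso {n : ℕ} (A B : Matrix (Fin n) (Fin n) ℤ) (T : GL (Fin n) ℚ) : Prop :=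
  IsIso A B T ∧ ¬ IsReducible A B T

/-- `A` acting on `Kⁿ`. -/
noncomputable def endo (K : Type*) [Field K] {n : ℕ} (A : Matrix (Fin n) (Fin n) ℤ) :
    Module.End K (Fin n → K) :=
  Matrix.toLin' (A.map (Int.cast : ℤ → K))

/-- The set of distinct eigenvalues of `A` in `K`. -/
def eigenvalueSet (K : Type*) [Field K] {n : ℕ} (A : Matrix (Fin n) (Fin n) ℤ) : Set K :=
  {x | (endo K A).HasEigenvalue x}

/-- The sum `U_M` of the generalized eigenspaces `K(A, x)`, `x ∈ M`. -/
noncomputable def genEigenspaceSum (K : Type*) [Field K] {n : ℕ}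
    (A : Matrix (Fin n) (Fin n) ℤ) (M : Set K) : Submodule K (Fin n → K) :=
  ⨆ x ∈ M, (endo K A).maxGenEigenspace x

/-- `M` and `M'` are sets of eigenvalues of `A` and of `B` with `T(U_M) = V_{M'}`. -/
def Corresponds (K : Type*) [Field K] [Algebra ℚ K] {n : ℕ} (A B : Matrix (Fin n) (Fin n) ℤ)
    (T : GL (Fin n) ℚ) (M M' : Set K) : Prop :=
  M ⊆ eigenvalueSet K A ∧ M' ⊆ eigenvalueSet K B ∧
    (genEigenspaceSum K A M).map
      (Matrix.toLin' ((T : Matrix (Fin n) (Fin n) ℚ).map (algebraMap ℚ K)))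
      = genEigenspaceSum K B M'

/-- `S` is a non-empty set of eigenvalues of `A` of the smallest cardinality among those for
which some set `S'` of eigenvalues of `B` satisfies `T(U_S) = V_{S'}`. -/
def IsSmallest (K : Type*) [Field K] [Algebra ℚ K] {n : ℕ} (A B : Matrix (Fin n) (Fin n) ℤ)
    (T : GL (Fin n) ℚ) (S : Set K) : Prop :=
  S.Nonempty ∧ (∃ S', Corresponds K A B T S S') ∧
    ∀ N : Set K, N.Nonempty → (∃ N', Corresponds K A B T N N') → S.ncard ≤ N.ncard

/-- `f = h₁^α₁ ⋯ h_k^α_k` with distinct monic irreducible `hᵢ ∈ ℤ[t]` and `αᵢ ≥ 1`. -/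
def IsFactorization (f : ℤ[X]) {k : ℕ} (h : Fin k → ℤ[X]) (α : Fin k → ℕ) : Prop :=
  (∀ i, (h i).Monic) ∧ (∀ i, Irreducible (h i)) ∧ Function.Injective h ∧ (∀ i, 1 ≤ α i) ∧
    f = ∏ i, h i ^ α i

/-- The part `Mᵢ` of `M` that consists of roots of `f = hᵢ`. -/
def part {K : Type*} [Field K] (f : ℤ[X]) (M : Set K) : Set K := M ∩ f.rootSet K

/-- `‖M‖ = ∑ αᵢ |Mᵢ|`. -/
noncomputable def weight {K : Type*} [Field K] {k : ℕ} (h : Fin k → ℤ[X]) (α : Fin k → ℕ)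
    (M : Set K) : ℕ :=
  ∑ i, α i * (part (h i) M).ncard

/-- The number of distinct roots of `f` in `K`. -/
noncomputable def numRoots (K : Type*) [Field K] (f : ℤ[X]) : ℕ := (f.rootSet K).ncard

/-- The multiplicity of zero in the reduction of `f` modulo `p`: this is `t_p(A)` for
`f = h_A`, and `t_{p,i}(A)` for `f = hᵢ`. -/
noncomputable def zeroMult (p : ℕ) (f : ℤ[X]) : ℕ :=
  (f.map (Int.castRingHom (ZMod p))).rootMultiplicity 0

/-- `𝒫'(A)`: the primes `p` dividing `det A` with `h_A ≢ tⁿ (mod p)`. -/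
def primeSet {n : ℕ} (A : Matrix (Fin n) (Fin n) ℤ) : Set ℕ :=
  {p | p.Prime ∧ (p : ℤ) ∣ A.det ∧ A.charpoly.map (Int.castRingHom (ZMod p)) ≠ X ^ n}

end Solenoid

/-! Fix a prime `p` and a prime `P` of `K` above it. The vectors whose whole `K`-line is carried,
multiple by multiple, into integral vectors at `P` by powers of `A` form a subspace
(`divisiblePart`). It is the sum of the generalized eigenspaces of the eigenvalues `λ` with `|λ|_P <
1` (`divisiblePart_eq`). Because `T` maps `G_A` onto `G_B`, it carries this subspace to the one for
`B`, so these sets of eigenvalues correspond under `T`. Their eigenspace sums have dimension `t_p`,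
whence `t_p(A) = t_p(B)` and equality of the prime sets.

Corresponding sets are closed under intersections, unions and, `T` being rational, the Galois group.
By minimality of `S`, a translate `σS` lies inside a corresponding set `M` or is disjoint from it
(`MinimalPair.image_subset_or_disjoint`). The union `W` of all translates is Galois stable, so `U_W`
contains nonzero rational vectors, and these form a rational `A`-invariant subspace with
`B`-invariant image under `T`. Were `W` not all of `Σ`, this subspace would be proper, and bases of
`ℤⁿ` adapted to it and to its image would make `T` reducible (`isReducible_of_invariant`). Hence `W
= Σ`.

So `Σ` is a disjoint union of `c` translates of `S`, and the eigenvalues in `P` form a disjoint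
union of `d` translates. Galois preserves the roots of each `hᵢ`, so `nᵢ = c|Sᵢ|` and `t_{p,i} =
d|Sᵢ|` with `c`, `d` independent of `i`. Weighting by `αᵢ` gives `n = c‖S‖` and `t_p = d‖S‖`, which
is everything claimed for `A`. For `B` the same argument applies to `S'` and `T⁻¹`. -/

namespace Solenoid

/-! ### Sums of generalized eigenspaces -/

section Eigenspaces

variable {K : Type*} [Field K] {n : ℕ} (A : Matrix (Fin n) (Fin n) ℤ)

theorem maxGenEigenspace_le_genEigenspaceSum {M : Set K} {x : K} (hx : x ∈ M) :
    (endo K A).maxGenEigenspace x ≤ genEigenspaceSum K A M :=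
  le_iSup₂_of_le (f := fun y (_ : y ∈ M) => (endo K A).maxGenEigenspace y) x hx le_rfl

theorem genEigenspaceSum_mono {M N : Set K} (h : M ⊆ N) :
    genEigenspaceSum K A M ≤ genEigenspaceSum K A N :=
  iSup₂_le fun _ hx => maxGenEigenspace_le_genEigenspaceSum A (h hx)

theorem genEigenspaceSum_iUnion {ι : Sort*} (M : ι → Set K) :
    genEigenspaceSum K A (⋃ i, M i) = ⨆ i, genEigenspaceSum K A (M i) := by
  apply le_antisymm
  · refine iSup₂_le fun x hx => ?_
    obtain ⟨i, hi⟩ := Set.mem_iUnion.mp hx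
    exact le_iSup_of_le i (maxGenEigenspace_le_genEigenspaceSum A hi)
  · exact iSup_le fun i => genEigenspaceSum_mono A (Set.subset_iUnion M i)

theorem disjoint_maxGenEigenspace_genEigenspaceSum {M : Set K} {x : K} (hx : x ∉ M) :
    Disjoint ((endo K A).maxGenEigenspace x) (genEigenspaceSum K A M) :=
  (Module.End.independent_maxGenEigenspace (endo K A)).disjoint_biSup hx

theorem maxGenEigenspace_ne_bot {x : K} (hx : x ∈ eigenvalueSet K A) :
    (endo K A).maxGenEigenspace x ≠ ⊥ := by
  have h1 : (endo K A).eigenspace x ≠ ⊥ := hx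
  intro h
  exact h1 (le_bot_iff.mp (h ▸ Module.End.eigenspace_le_maxGenEigenspace))

theorem maxGenEigenspace_le_genEigenspaceSum_iff {M : Set K} {x : K}
    (hx : x ∈ eigenvalueSet K A) :
    (endo K A).maxGenEigenspace x ≤ genEigenspaceSum K A M ↔ x ∈ M := by
  refine ⟨fun h => ?_, maxGenEigenspace_le_genEigenspaceSum A⟩
  by_contra hxM
  have := disjoint_maxGenEigenspace_genEigenspaceSum A hxM
  exact maxGenEigenspace_ne_bot A hx (disjoint_self.mp (this.mono_right h))

theorem genEigenspaceSum_le_iff {M N : Set K} (hM : M ⊆ eigenvalueSet K A) :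
    genEigenspaceSum K A M ≤ genEigenspaceSum K A N ↔ M ⊆ N :=
  ⟨fun h _ hx => (maxGenEigenspace_le_genEigenspaceSum_iff A (hM hx)).mp
    ((maxGenEigenspace_le_genEigenspaceSum A hx).trans h), genEigenspaceSum_mono A⟩

theorem genEigenspaceSum_injOn {M N : Set K} (hM : M ⊆ eigenvalueSet K A)
    (hN : N ⊆ eigenvalueSet K A) (h : genEigenspaceSum K A M = genEigenspaceSum K A N) :
    M = N :=
  Set.Subset.antisymm ((genEigenspaceSum_le_iff A hM).mp h.le)
    ((genEigenspaceSum_le_iff A hN).mp h.ge)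

theorem endo_mem_maxGenEigenspace (x : K) {v : Fin n → K}
    (hv : v ∈ (endo K A).maxGenEigenspace x) :
    endo K A v ∈ (endo K A).maxGenEigenspace x :=
  Module.End.mapsTo_maxGenEigenspace_of_comm (Commute.refl _) x hv

theorem genEigenspaceSum_invariant (M : Set K) :
    genEigenspaceSum K A M ≤ (genEigenspaceSum K A M).comap (endo K A) :=
  iSup₂_le fun x hx _ hv =>
    maxGenEigenspace_le_genEigenspaceSum A hx (endo_mem_maxGenEigenspace A x hv)

/-- An invariant subspace of the total generalized eigenspace is the sum of its intersections with
the individual ones, so it suffices to know that each is either contained in it or meets it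
trivially. -/
theorem eq_genEigenspaceSum_of_invariant {p : Submodule K (Fin n → K)}
    (hp : ∀ v ∈ p, endo K A v ∈ p) (M : Set K)
    (hle : p ≤ ⨆ x, (endo K A).maxGenEigenspace x)
    (h1 : ∀ x ∈ M, (endo K A).maxGenEigenspace x ≤ p)
    (h2 : ∀ x ∉ M, p ⊓ (endo K A).maxGenEigenspace x = ⊥) :
    p = genEigenspaceSum K A M := by
  apply le_antisymm _ (iSup₂_le h1)
  rw [← inf_eq_left.mpr hle]
  change p ⊓ ⨆ x, (endo K A).genEigenspace x ⊤ ≤ _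
  rw [Submodule.inf_iSup_genEigenspace hp]
  refine iSup_le fun x => ?_
  by_cases hx : x ∈ M
  · exact inf_le_right.trans (maxGenEigenspace_le_genEigenspaceSum A hx)
  · exact (h2 x hx).le.trans bot_le

theorem genEigenspaceSum_inter (M N : Set K) :
    genEigenspaceSum K A (M ∩ N) = genEigenspaceSum K A M ⊓ genEigenspaceSum K A N := by
  symm
  apply eq_genEigenspaceSum_of_invariant
  · intro v hv
    exact ⟨genEigenspaceSum_invariant A M hv.1, genEigenspaceSum_invariant A N hv.2⟩
  · exact inf_le_left.trans (iSup₂_le fun x _ => le_iSup _ x)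
  · intro x hx
    exact le_inf (maxGenEigenspace_le_genEigenspaceSum A hx.1)
      (maxGenEigenspace_le_genEigenspaceSum A hx.2)
  · intro x hx
    rw [← disjoint_iff]
    by_cases hM : x ∈ M
    · have hN : x ∉ N := fun hN => hx ⟨hM, hN⟩
      exact (disjoint_maxGenEigenspace_genEigenspaceSum A hN).symm.mono_left inf_le_right
    · exact (disjoint_maxGenEigenspace_genEigenspaceSum A hM).symm.mono_left inf_le_left

theorem genEigenspaceSum_empty : genEigenspaceSum K A ∅ = ⊥ := by
  simp [genEigenspaceSum]

theorem charpoly_endo :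
    (endo K A).charpoly = A.charpoly.map (algebraMap ℤ K) := by
  rw [endo, ← LinearMap.charpoly_toMatrix _ (Pi.basisFun K (Fin n))]
  rw [← Matrix.toLin_eq_toLin', LinearMap.toMatrix_toLin, ← Matrix.charpoly_map]
  rfl

theorem mem_eigenvalueSet_iff {x : K} :
    x ∈ eigenvalueSet K A ↔ x ∈ (A.charpoly.map (algebraMap ℤ K)).roots := by
  rw [mem_roots ((A.charpoly_monic.map _).ne_zero), ← charpoly_endo,
    ← Module.End.hasEigenvalue_iff_isRoot_charpoly]
  rfl

theorem finrank_genEigenspaceSum (M : Finset K) :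
    Module.finrank K (genEigenspaceSum K A (M : Set K)) =
      ∑ x ∈ M, (A.charpoly.map (algebraMap ℤ K)).rootMultiplicity x := by
  classical
  induction M using Finset.induction_on with
  | empty => simp [genEigenspaceSum_empty]
  | insert a s ha ih =>
    rw [Finset.sum_insert ha, ← ih, ← charpoly_endo, ← LinearMap.finrank_maxGenEigenspace_eq]
    have hd : Disjoint ((endo K A).maxGenEigenspace a) (genEigenspaceSum K A (s : Set K)) :=
      disjoint_maxGenEigenspace_genEigenspaceSum A (by simpa using ha)
    have := Submodule.finrank_sup_add_finrank_inf_eq ((endo K A).maxGenEigenspace a)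
      (genEigenspaceSum K A (s : Set K))
    rw [hd.eq_bot, finrank_bot, add_zero] at this
    have e : genEigenspaceSum K A ((insert a s : Finset K) : Set K) =
        (endo K A).maxGenEigenspace a ⊔ genEigenspaceSum K A (s : Set K) := by
      simp only [genEigenspaceSum, Finset.coe_insert, iSup_insert]
    rw [← this, e]

theorem finite_eigenvalueSet : (eigenvalueSet K A).Finite := by
  classical
  refine (Finset.finite_toSet (A.charpoly.map (algebraMap ℤ K)).roots.toFinset).subset ?_
  intro x hx
  simpa using (mem_eigenvalueSet_iff A).mp hx

theorem genEigenspaceSum_eigenvalueSet (hAK : (A.charpoly.map (algebraMap ℤ K)).Splits) :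
    genEigenspaceSum K A (eigenvalueSet K A) = ⊤ := by
  classical
  have hset : eigenvalueSet K A =
      ((A.charpoly.map (algebraMap ℤ K)).roots.toFinset : Set K) := by
    ext x
    simp only [Multiset.mem_toFinset, Finset.mem_coe, mem_eigenvalueSet_iff]
  apply Submodule.eq_top_of_finrank_eq
  rw [hset, finrank_genEigenspaceSum]
  simp_rw [← count_roots]
  rw [Multiset.toFinset_sum_count_eq, ← hAK.natDegree_eq_card_roots,
    (A.charpoly_monic).natDegree_map, Matrix.charpoly_natDegree_eq_dim]
  simp

theorem iSup_maxGenEigenspace_endo (hAK : (A.charpoly.map (algebraMap ℤ K)).Splits) :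
    ⨆ x, (endo K A).maxGenEigenspace x = ⊤ :=
  top_le_iff.mp ((genEigenspaceSum_eigenvalueSet A hAK).ge.trans
    (iSup₂_le fun x _ => le_iSup _ x))

end Eigenspaces

/-! ### Galois action on eigenspaces -/

section Galois

variable {K : Type*} [Field K] {n : ℕ} (A : Matrix (Fin n) (Fin n) ℤ) (σ : K ≃+* K)

/-- A field automorphism acting coordinatewise. -/
def coordMap (n : ℕ) : (Fin n → K) →ₛₗ[(σ : K →+* K)] (Fin n → K) where
  toFun v := fun i => σ (v i)
  map_add' _ _ := by ext; simp
  map_smul' _ _ := by ext; simp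

@[simp] theorem coordMap_apply (v : Fin n → K) (i : Fin n) : coordMap σ n v i = σ (v i) := rfl

theorem coordMap_mulVec (P : Matrix (Fin n) (Fin n) K) (hP : P.map σ = P) (v : Fin n → K) :
    coordMap σ n (P *ᵥ v) = P *ᵥ coordMap σ n v := by
  conv_rhs => rw [← hP]
  ext i
  simp [Matrix.mulVec, dotProduct]

theorem coordMap_endo (v : Fin n → K) :
    coordMap σ n (endo K A v) = endo K A (coordMap σ n v) := by
  simp only [endo, Matrix.toLin'_apply]
  apply coordMap_mulVec
  ext; simp

/-- The entries of `A` are fixed by `σ`, so the coordinatewise action intertwines `A - x` with `A -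
σ x`. -/
theorem coordMap_mem_maxGenEigenspace {x : K} {v : Fin n → K}
    (hv : v ∈ (endo K A).maxGenEigenspace x) :
    coordMap σ n v ∈ (endo K A).maxGenEigenspace (σ x) := by
  rw [Module.End.mem_maxGenEigenspace] at hv ⊢
  obtain ⟨k, hk⟩ := hv
  refine ⟨k, ?_⟩
  have key : ∀ (k : ℕ) (w : Fin n → K), coordMap σ n (((endo K A - x • 1) ^ k) w) =
      ((endo K A - σ x • 1) ^ k) (coordMap σ n w) := by
    intro k
    induction k with
    | zero => intro w; simp
    | succ k ih =>
      intro w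
      rw [pow_succ, pow_succ, Module.End.mul_apply, Module.End.mul_apply, ih]
      congr 1
      simp only [LinearMap.sub_apply, LinearMap.smul_apply, Module.End.one_apply, map_sub,
        coordMap_endo]
      congr 1
      ext; simp
  rw [← key, hk, map_zero]

theorem genEigenspaceSum_le_comap_coordMap (M : Set K) :
    genEigenspaceSum K A M ≤ (genEigenspaceSum K A (σ '' M)).comap (coordMap σ n) :=
  iSup₂_le fun _ hx _ hv => maxGenEigenspace_le_genEigenspaceSum A
    (Set.mem_image_of_mem _ hx) (coordMap_mem_maxGenEigenspace A σ hv)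

theorem coordMap_mem_genEigenspaceSum_iff (M : Set K) (v : Fin n → K) :
    coordMap σ n v ∈ genEigenspaceSum K A (σ '' M) ↔ v ∈ genEigenspaceSum K A M := by
  refine ⟨fun h => ?_, fun h => genEigenspaceSum_le_comap_coordMap A σ M h⟩
  have h2 := genEigenspaceSum_le_comap_coordMap A σ.symm _ h
  have e1 : coordMap σ.symm n (coordMap σ n v) = v := by ext; simp
  have e2 : σ.symm '' (σ '' M) = M := by
    rw [← Set.image_comp]; simp
  rw [Submodule.mem_comap, e2] at h2
  rwa [e1] at h2

theorem image_subset_eigenvalueSet {M : Set K} (hM : M ⊆ eigenvalueSet K A) :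
    σ '' M ⊆ eigenvalueSet K A := by
  rintro _ ⟨x, hx, rfl⟩
  have := hM hx
  rw [mem_eigenvalueSet_iff, mem_roots ((A.charpoly_monic.map _).ne_zero), IsRoot.def,
    eval_map_algebraMap] at this ⊢
  have h2 := congrArg σ this
  rw [map_zero] at h2
  rw [← h2]
  exact (Polynomial.map_aeval_eq_aeval_map (φ := RingHom.id ℤ) (ψ := (σ : K →+* K))
    (RingHom.ext_int _ _) _ _ ▸ by simp)

end Galois

/-! ### The groups `G_A` and their isomorphisms -/

section GroupSet

variable {n : ℕ} {A B : Matrix (Fin n) (Fin n) ℤ}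

theorem isUnit_det_map_intCast (hA : A.det ≠ 0) : IsUnit (A.map (Int.cast : ℤ → ℚ)).det := by
  have : (A.map (Int.cast : ℤ → ℚ)).det = (A.det : ℚ) := (Int.cast_det A).symm
  rw [this, isUnit_iff_ne_zero]
  exact_mod_cast hA

theorem map_intCast_mulVec {R : Type*} [Ring R] {m l : ℕ} (A : Matrix (Fin m) (Fin l) ℤ)
    (x : Fin l → ℤ) :
    A.map (Int.cast : ℤ → R) *ᵥ (fun i => (x i : R)) = fun i => ((A *ᵥ x) i : R) := by
  ext i
  simp [Matrix.mulVec, dotProduct]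

theorem map_intCast_pow {R : Type*} [Ring R] (A : Matrix (Fin n) (Fin n) ℤ) (k : ℕ) :
    (A.map (Int.cast : ℤ → R)) ^ k = (A ^ k).map (Int.cast : ℤ → R) :=
  (map_pow (Int.castRingHom R).mapMatrix A k).symm

/-- Nonnegative powers of `A` preserve `ℤⁿ`, so only the negative powers in the definition
contribute new vectors. -/
theorem mem_groupSet_iff (hA : A.det ≠ 0) (v : Fin n → ℚ) :
    v ∈ groupSet A ↔ ∃ (k : ℕ) (x : Fin n → ℤ),
      (A.map (Int.cast : ℤ → ℚ)) ^ k *ᵥ v = fun i => (x i : ℚ) := by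
  have hu := isUnit_det_map_intCast hA
  constructor
  · rintro ⟨k, x, rfl⟩
    obtain ⟨m, rfl | rfl⟩ := k.eq_nat_or_neg
    · refine ⟨m, x, ?_⟩
      rw [Matrix.zpow_neg hu, zpow_natCast, Matrix.mulVec_mulVec, Matrix.mul_nonsing_inv,
        Matrix.one_mulVec]
      rw [Matrix.det_pow]
      exact hu.pow m
    · refine ⟨0, (A ^ m) *ᵥ x, ?_⟩
      rw [neg_neg, zpow_natCast, pow_zero, Matrix.one_mulVec, map_intCast_pow,
        map_intCast_mulVec]
  · rintro ⟨k, x, h⟩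
    refine ⟨k, x, ?_⟩
    rw [← h, Matrix.zpow_neg hu, zpow_natCast, Matrix.mulVec_mulVec, Matrix.nonsing_inv_mul,
      Matrix.one_mulVec]
    rw [Matrix.det_pow]
    exact hu.pow k

theorem integral_pow_mulVec_of_le {k m : ℕ} (hkm : k ≤ m) {v : Fin n → ℚ} {x : Fin n → ℤ}
    (h : (A.map (Int.cast : ℤ → ℚ)) ^ k *ᵥ v = fun i => (x i : ℚ)) :
    ∃ y : Fin n → ℤ, (A.map (Int.cast : ℤ → ℚ)) ^ m *ᵥ v = fun i => (y i : ℚ) := by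
  obtain ⟨d, rfl⟩ := Nat.exists_eq_add_of_le hkm
  refine ⟨(A ^ d) *ᵥ x, ?_⟩
  rw [add_comm, pow_add, ← Matrix.mulVec_mulVec, h, map_intCast_pow, map_intCast_mulVec]

/-- The columns of `T A⁻ᵏ` lie in `G_B`, and since there are finitely many, one power of `B` makes
them all integral. The resulting matrix identity survives extension of scalars to `K`. -/
theorem IsIso.exists_pow_mul_eq (hA : A.det ≠ 0) (hB : B.det ≠ 0) {T : GL (Fin n) ℚ}
    (hT : IsIso A B T) (k : ℕ) :
    ∃ (m : ℕ) (N : Matrix (Fin n) (Fin n) ℤ),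
      (B.map (Int.cast : ℤ → ℚ)) ^ m * (T : Matrix (Fin n) (Fin n) ℚ) =
        N.map (Int.cast : ℤ → ℚ) * (A.map (Int.cast : ℤ → ℚ)) ^ k := by
  have hu : IsUnit ((A.map (Int.cast : ℤ → ℚ)) ^ k).det := by
    rw [Matrix.det_pow]
    exact (isUnit_det_map_intCast hA).pow k
  set Ak := (A.map (Int.cast : ℤ → ℚ)) ^ k with hAk
  have hcol : ∀ j : Fin n, ∃ (m : ℕ) (y : Fin n → ℤ), (B.map (Int.cast : ℤ → ℚ)) ^ m *ᵥ
      ((T : Matrix (Fin n) (Fin n) ℚ) *ᵥ (Ak⁻¹ *ᵥ Pi.single j 1)) = fun i => (y i : ℚ) := by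
    intro j
    rw [← mem_groupSet_iff hB, ← hT]
    refine ⟨_, (mem_groupSet_iff hA _).mpr ⟨k, Pi.single j 1, ?_⟩, rfl⟩
    rw [Matrix.mulVec_mulVec, ← hAk, Matrix.mul_nonsing_inv _ hu, Matrix.one_mulVec]
    ext i
    by_cases hij : i = j
    · subst hij; simp
    · simp [hij]
  choose m y hy using hcol
  have hM : ∀ j, ∃ z : Fin n → ℤ, (B.map (Int.cast : ℤ → ℚ)) ^ (Finset.univ.sup m) *ᵥ
      ((T : Matrix (Fin n) (Fin n) ℚ) *ᵥ (Ak⁻¹ *ᵥ Pi.single j 1)) = fun i => (z i : ℚ) :=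
    fun j => integral_pow_mulVec_of_le (Finset.le_sup (Finset.mem_univ j)) (hy j)
  choose z hz using hM
  refine ⟨Finset.univ.sup m, Matrix.of fun i j => z j i, ?_⟩
  have key : (B.map (Int.cast : ℤ → ℚ)) ^ (Finset.univ.sup m) *
      ((T : Matrix (Fin n) (Fin n) ℚ) * Ak⁻¹) =
      (Matrix.of fun i j => z j i).map (Int.cast : ℤ → ℚ) := by
    ext i j
    have := congrFun (hz j) i
    rw [Matrix.mulVec_mulVec, Matrix.mulVec_mulVec, Matrix.mulVec_single_one] at this
    rw [Matrix.mul_assoc] at this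
    simpa using this
  rw [← key, Matrix.mul_assoc, Matrix.mul_assoc, Matrix.nonsing_inv_mul _ hu, Matrix.mul_one]

theorem IsIso.symm {T : GL (Fin n) ℚ} (hT : IsIso A B T) : IsIso B A T⁻¹ := by
  unfold IsIso at *
  rw [← hT, ← Set.image_comp]
  convert Set.image_id _
  ext v
  simp [Matrix.mulVec_mulVec]

end GroupSet

/-! ### The divisible part at a valuation -/

section DivisiblePart

variable {K : Type*} [Field K] {Γ : Type*} [LinearOrderedCommGroupWithZero Γ]
  (v : Valuation K Γ) {n : ℕ} (A B : Matrix (Fin n) (Fin n) ℤ)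

theorem integral_map_intCast_mulVec (N : Matrix (Fin n) (Fin n) ℤ) {w : Fin n → K}
    (hw : ∀ i, w i ∈ v.integer) (i : Fin n) :
    (N.map (Int.cast : ℤ → K) *ᵥ w) i ∈ v.integer := by
  simp only [Matrix.mulVec, dotProduct, Matrix.map_apply]
  exact sum_mem fun j _ => mul_mem (intCast_mem _ _) (hw j)

theorem endo_pow_apply (k : ℕ) (w : Fin n → K) :
    (endo K A ^ k) w = ((A ^ k).map (Int.cast : ℤ → K)) *ᵥ w := by
  rw [endo, ← Matrix.toLin'_pow, Matrix.toLin'_apply, map_intCast_pow]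

variable {A} in
theorem integral_endo_pow_of_le {k m : ℕ} (hkm : k ≤ m) {w : Fin n → K}
    (hw : ∀ i, (endo K A ^ k) w i ∈ v.integer) (i : Fin n) :
    (endo K A ^ m) w i ∈ v.integer := by
  obtain ⟨d, rfl⟩ := Nat.exists_eq_add_of_le hkm
  rw [add_comm, pow_add, Module.End.mul_apply, endo_pow_apply]
  exact integral_map_intCast_mulVec v _ hw i

/-- The largest `K`-subspace contained in `⋃ₖ A⁻ᵏ Rⁿ`, where `R` is the valuation ring of `v`. -/
def divisiblePart : Submodule K (Fin n → K) where
  carrier := {x | ∀ c : K, ∃ k : ℕ, ∀ i, (endo K A ^ k) (c • x) i ∈ v.integer}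
  zero_mem' c := ⟨0, fun i => by simp⟩
  add_mem' {x y} hx hy c := by
    obtain ⟨k, hk⟩ := hx c
    obtain ⟨m, hm⟩ := hy c
    refine ⟨max k m, fun i => ?_⟩
    rw [smul_add, map_add]
    exact add_mem (integral_endo_pow_of_le v (le_max_left _ _) hk i)
      (integral_endo_pow_of_le v (le_max_right _ _) hm i)
  smul_mem' a x hx c := by
    rw [smul_smul]
    exact hx _

variable {A} in
theorem endo_mem_divisiblePart {x : Fin n → K} (hx : x ∈ divisiblePart v A) :
    endo K A x ∈ divisiblePart v A := by
  intro c
  obtain ⟨k, hk⟩ := hx c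
  refine ⟨k, fun i => ?_⟩
  rw [← map_smul, ← Module.End.mul_apply, ← pow_succ]
  exact integral_endo_pow_of_le v (Nat.le_succ k) hk i

theorem endo_pow_sub_mem {p : Submodule K (Fin n → K)} (hp : ∀ x ∈ p, endo K A x ∈ p) {a : K}
    {x : Fin n → K} (h : endo K A x - a • x ∈ p) (k : ℕ) :
    (endo K A ^ k) x - a ^ k • x ∈ p := by
  induction k with
  | zero => simp
  | succ k ih =>
    have : (endo K A ^ (k + 1)) x - a ^ (k + 1) • x =
        endo K A ((endo K A ^ k) x - a ^ k • x) + a ^ k • (endo K A x - a • x) := by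
      rw [pow_succ', Module.End.mul_apply, map_sub, map_smul, smul_sub, smul_smul, pow_succ]
      abel
    rw [this]
    exact add_mem (hp _ ih) (p.smul_mem _ h)

theorem exists_pow_smul_integral [MulArchimedean Γ] {a : K} (ha : v a < 1) (x : Fin n → K) :
    ∃ k : ℕ, ∀ i, (a ^ k • x) i ∈ v.integer := by
  have h1 : ∀ i, ∃ k : ℕ, v (a ^ k * x i) ≤ 1 := by
    intro i
    rcases eq_or_ne (x i) 0 with h0 | h0
    · exact ⟨0, by simp [h0]⟩
    · obtain ⟨k, hk⟩ := exists_pow_lt₀ ha (Units.mk0 (v (x i)) (v.ne_zero_iff.mpr h0))⁻¹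
      refine ⟨k, ?_⟩
      rw [map_mul, map_pow]
      rw [Units.val_inv_eq_inv_val, Units.val_mk0] at hk
      calc v a ^ k * v (x i) ≤ (v (x i))⁻¹ * v (x i) := by gcongr
        _ = 1 := inv_mul_cancel₀ (v.ne_zero_iff.mpr h0)
  choose k hk using h1
  refine ⟨Finset.univ.sup k, fun i => ?_⟩
  obtain ⟨d, hd⟩ := Nat.exists_eq_add_of_le (Finset.le_sup (f := k) (Finset.mem_univ i))
  rw [hd, pow_add, Pi.smul_apply, smul_eq_mul, mul_right_comm]
  refine mul_mem (hk i) ?_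
  rw [Valuation.mem_integer_iff, map_pow]
  exact pow_le_one' ha.le d

/-- Induction on the height of the generalized eigenvector `x`. Modulo the divisible part, `Aᵏ x` is
`aᵏ x`; the multiple `aᵏ c x` is integral for large `k`, and a further power of `A` makes the
remainder integral. -/
theorem maxGenEigenspace_le_divisiblePart [MulArchimedean Γ] {a : K} (ha : v a < 1) :
    (endo K A).maxGenEigenspace a ≤ divisiblePart v A := by
  intro x hx
  rw [Module.End.mem_maxGenEigenspace] at hx
  obtain ⟨m, hm⟩ := hx
  induction m generalizing x with
  | zero =>
    rw [pow_zero, Module.End.one_apply] at hm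
    rw [hm]
    exact zero_mem _
  | succ m ih =>
    have hN : endo K A x - a • x ∈ divisiblePart v A := by
      apply ih
      rw [pow_succ, Module.End.mul_apply] at hm
      simpa using hm
    intro c
    obtain ⟨k, hk⟩ := exists_pow_smul_integral v ha (c • x)
    have hd := endo_pow_sub_mem A (fun _ => endo_mem_divisiblePart v) hN k
    obtain ⟨j, hj⟩ := hd c
    refine ⟨j + k, fun i => ?_⟩
    have e : (endo K A ^ (j + k)) (c • x) = (endo K A ^ j) (a ^ k • c • x) +
        (endo K A ^ j) (c • ((endo K A ^ k) x - a ^ k • x)) := by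
      rw [pow_add, Module.End.mul_apply, ← map_add]
      congr 1
      rw [smul_sub, map_smul, smul_comm c]
      abel
    rw [e]
    refine add_mem ?_ (hj i)
    exact integral_endo_pow_of_le v (Nat.zero_le j) (by simpa using hk) i

/-- Induction on the height reduces to a genuine eigenvector. There `Aᵏ` multiplies by the unit
`aᵏ`, which never improves integrality, so no nonzero line can become integral. -/
theorem divisiblePart_inf_maxGenEigenspace {a : K} (ha : v a = 1) (hv : ∃ b : K, 1 < v b) :
    divisiblePart v A ⊓ (endo K A).maxGenEigenspace a = ⊥ := by
  have key : ∀ (m : ℕ) (x : Fin n → K), x ∈ divisiblePart v A →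
      ((endo K A - a • 1) ^ m) x = 0 → x = 0 := by
    intro m
    induction m with
    | zero => intro x _ h; simpa using h
    | succ m ih =>
      intro x hx h
      have h1 : endo K A x - a • x = 0 := by
        apply ih
        · exact sub_mem (endo_mem_divisiblePart v hx) (Submodule.smul_mem _ _ hx)
        · rw [pow_succ, Module.End.mul_apply] at h
          simpa using h
      have h2 : ∀ k : ℕ, (endo K A ^ k) x = a ^ k • x := fun k => by
        have := endo_pow_sub_mem (p := (⊥ : Submodule K (Fin n → K))) A (by simp)
          (by simpa using h1) k
        rwa [Submodule.mem_bot, sub_eq_zero] at this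
      have h3 : ∀ (c : K) (i : Fin n), v (c * x i) ≤ 1 := by
        intro c i
        obtain ⟨k, hk⟩ := hx c
        have := hk i
        rw [map_smul, h2, Valuation.mem_integer_iff] at this
        simpa [ha] using this
      obtain ⟨b, hb⟩ := hv
      ext i
      by_contra h0
      -- This scalar turns the `i`-th coordinate into `b`, which is not integral.
      have h4 := h3 (b * (x i)⁻¹) i
      rw [mul_assoc, inv_mul_cancel₀ h0, mul_one] at h4
      exact absurd hb (not_lt.mpr h4)
  rw [eq_bot_iff]
  rintro x ⟨hx1, hx2⟩
  rw [SetLike.mem_coe, Module.End.mem_maxGenEigenspace] at hx2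
  obtain ⟨m, hm⟩ := hx2
  exact (Submodule.mem_bot K).mpr (key m x hx1 hm)

theorem eigenvalue_integral {a : K} (ha : a ∈ eigenvalueSet K A) : v a ≤ 1 := by
  rw [mem_eigenvalueSet_iff, mem_roots ((A.charpoly_monic.map _).ne_zero)] at ha
  have : IsIntegral ℤ a := ⟨A.charpoly, A.charpoly_monic, by
    rwa [IsRoot.def, eval_map] at ha⟩
  exact (Valuation.integer.integers v).mem_of_integral this.tower_top

theorem divisiblePart_eq [MulArchimedean Γ] (hv : ∃ b : K, 1 < v b)
    (hAK : (A.charpoly.map (algebraMap ℤ K)).Splits) :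
    divisiblePart v A = genEigenspaceSum K A {a ∈ eigenvalueSet K A | v a < 1} := by
  apply eq_genEigenspaceSum_of_invariant
  · exact fun _ => endo_mem_divisiblePart v
  · rw [iSup_maxGenEigenspace_endo A hAK]
    exact le_top
  · exact fun a ha => maxGenEigenspace_le_divisiblePart v A ha.2
  · intro a ha
    by_cases hS : a ∈ eigenvalueSet K A
    · have : v a = 1 := le_antisymm (eigenvalue_integral v A hS)
        (not_lt.mp fun h => ha ⟨hS, h⟩)
      exact divisiblePart_inf_maxGenEigenspace v A this hv
    · have h1 : (endo K A).maxGenEigenspace a = ⊥ := by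
        by_contra h
        apply hS
        have h' : (endo K A).HasUnifEigenvalue a ⊤ := h
        exact h'.lt zero_lt_one
      rw [h1, inf_bot_eq]

end DivisiblePart

/-! ### Transport of the divisible part by `T` -/

section Transport

variable {K : Type*} [Field K] [Algebra ℚ K] {Γ : Type*} [LinearOrderedCommGroupWithZero Γ]
  (v : Valuation K Γ) {n : ℕ} {A B : Matrix (Fin n) (Fin n) ℤ}

theorem map_intCast_map_algebraMap (A : Matrix (Fin n) (Fin n) ℤ) :
    (A.map (Int.cast : ℤ → ℚ)).map (algebraMap ℚ K) = A.map (Int.cast : ℤ → K) := by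
  ext; simp

/-- If `Aᵏ` makes `c x` integral, then `Bᵐ T = N Aᵏ` with `N` an integer matrix shows that `Bᵐ`
makes `c T x` integral. -/
theorem IsIso.map_divisiblePart_le (hA : A.det ≠ 0) (hB : B.det ≠ 0) {T : GL (Fin n) ℚ}
    (hT : IsIso A B T) :
    (divisiblePart v A).map
      (Matrix.toLin' ((T : Matrix (Fin n) (Fin n) ℚ).map (algebraMap ℚ K))) ≤
      divisiblePart v B := by
  rintro _ ⟨x, hx, rfl⟩ c
  obtain ⟨k, hk⟩ := hx c
  obtain ⟨m, N, h⟩ := hT.exists_pow_mul_eq hA hB k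
  refine ⟨m, fun i => ?_⟩
  have h' := congrArg (algebraMap ℚ K).mapMatrix h
  simp only [map_mul, RingHom.mapMatrix_apply, map_intCast_pow, map_intCast_map_algebraMap] at h'
  rw [endo_pow_apply, Matrix.toLin'_apply, ← Matrix.mulVec_smul, Matrix.mulVec_mulVec, h',
    ← Matrix.mulVec_mulVec, ← endo_pow_apply]
  exact integral_map_intCast_mulVec v N hk i

theorem toLin'_inv_comp (T : GL (Fin n) ℚ) (x : Fin n → K) :
    Matrix.toLin' (((T⁻¹ : GL (Fin n) ℚ) : Matrix (Fin n) (Fin n) ℚ).map (algebraMap ℚ K))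
      (Matrix.toLin' ((T : Matrix (Fin n) (Fin n) ℚ).map (algebraMap ℚ K)) x) = x := by
  rw [Matrix.toLin'_apply, Matrix.toLin'_apply, Matrix.mulVec_mulVec]
  have := congrArg (algebraMap ℚ K).mapMatrix (Units.inv_mul T)
  rw [map_mul, map_one] at this
  rw [RingHom.mapMatrix_apply, RingHom.mapMatrix_apply] at this
  rw [this, Matrix.one_mulVec]

theorem IsIso.map_divisiblePart (hA : A.det ≠ 0) (hB : B.det ≠ 0) {T : GL (Fin n) ℚ}
    (hT : IsIso A B T) :
    (divisiblePart v A).map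
      (Matrix.toLin' ((T : Matrix (Fin n) (Fin n) ℚ).map (algebraMap ℚ K))) =
      divisiblePart v B := by
  refine le_antisymm (hT.map_divisiblePart_le v hA hB) fun y hy => ?_
  refine ⟨_, hT.symm.map_divisiblePart_le v hB hA ⟨y, hy, rfl⟩, ?_⟩
  have := toLin'_inv_comp (T⁻¹) y
  rwa [inv_inv] at this

theorem IsIso.corresponds_valuation [MulArchimedean Γ] (hA : A.det ≠ 0) (hB : B.det ≠ 0)
    (hv : ∃ b : K, 1 < v b) (hAK : (A.charpoly.map (algebraMap ℤ K)).Splits)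
    (hBK : (B.charpoly.map (algebraMap ℤ K)).Splits) {T : GL (Fin n) ℚ} (hT : IsIso A B T) :
    Corresponds K A B T {a ∈ eigenvalueSet K A | v a < 1} {a ∈ eigenvalueSet K B | v a < 1} := by
  refine ⟨fun _ h => h.1, fun _ h => h.1, ?_⟩
  rw [← divisiblePart_eq v A hv hAK, ← divisiblePart_eq v B hv hBK]
  exact hT.map_divisiblePart v hA hB

end Transport

/-! ### Saturated sublattices and block triangular form -/

section PrimitiveLattice

variable {n : ℕ}

theorem exists_equiv_extending {m n : ℕ} (f : Fin m ↪ Fin n) :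
    ∃ (l : ℕ) (_ : m + l = n) (e : Fin m ⊕ Fin l ≃ Fin n), ∀ i, e (Sum.inl i) = f i := by
  classical
  have hcard := Fintype.card_congr (Equiv.Set.sumCompl (Set.range f))
  rw [Fintype.card_sum, Set.card_range_of_injective f.injective, Fintype.card_fin,
    Fintype.card_fin] at hcard
  let e1 : Fin m ≃ Set.range f := Equiv.ofInjective f f.injective
  let e2 := (Fintype.equivFin ((Set.range f)ᶜ : Set (Fin n))).symm
  refine ⟨_, hcard, (Equiv.sumCongr e1 e2).trans (Equiv.Set.sumCompl (Set.range f)), ?_⟩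
  intro i
  simp [e1]

/-- In Smith normal form `L` is spanned by multiples of some of the basis vectors; saturation puts
these basis vectors themselves in `L`. -/
theorem exists_basis_of_saturated (L : Submodule ℤ (Fin n → ℤ))
    (hL : ∀ (a : ℤ) (x : Fin n → ℤ), a ≠ 0 → a • x ∈ L → x ∈ L) :
    ∃ (m l : ℕ) (_ : m + l = n) (b : Module.Basis (Fin m ⊕ Fin l) ℤ (Fin n → ℤ)),
      ∀ x, x ∈ L ↔ ∀ j, b.repr x (Sum.inr j) = 0 := by
  obtain ⟨m, snf⟩ := Submodule.smithNormalForm (Pi.basisFun ℤ (Fin n)) L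
  obtain ⟨l, h, e, he⟩ := exists_equiv_extending snf.f
  have hmem : ∀ i, snf.bM (snf.f i) ∈ L := by
    intro i
    have h1 := snf.snf i
    apply hL (snf.a i)
    · intro h0
      rw [h0, zero_smul] at h1
      exact snf.bN.ne_zero i (Subtype.ext h1)
    · rw [← h1]
      exact (snf.bN i).2
  refine ⟨m, l, h, snf.bM.reindex e.symm, fun x => ⟨fun hx j => ?_, fun hx => ?_⟩⟩
  · rw [Module.Basis.repr_reindex_apply, Equiv.symm_symm]
    have hr : e (Sum.inr j) ∉ Set.range snf.f := by
      rintro ⟨i, hi⟩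
      rw [← he] at hi
      simpa using e.injective hi
    exact snf.repr_eq_zero_of_notMem_range ⟨x, hx⟩ hr
  · rw [← (snf.bM.reindex e.symm).sum_repr x, Fintype.sum_sum_type]
    refine add_mem (sum_mem fun i _ => L.smul_mem _ ?_) (sum_mem fun j _ => ?_)
    · rw [Module.Basis.reindex_apply, Equiv.symm_symm, he]
      exact hmem i
    · rw [hx j, zero_smul]
      exact zero_mem L

theorem exists_int_smul (v : Fin n → ℚ) :
    ∃ (d : ℤ) (y : Fin n → ℤ), d ≠ 0 ∧ (d : ℚ) • v = fun i => (y i : ℚ) := by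
  obtain ⟨d, hd⟩ := IsLocalization.exist_integer_multiples_of_finite (nonZeroDivisors ℤ) v
  choose y hy using hd
  refine ⟨d, y, nonZeroDivisors.ne_zero d.2, ?_⟩
  ext i
  have := hy i
  simp only [eq_intCast] at this
  rw [this]
  simp

/-- The vectors whose last coordinates vanish are the image of `blockEmb`. -/
theorem exists_eq_blockEmb_iff {m l : ℕ} (h : m + l = n) (w : Fin n → ℚ) :
    (∃ x, w = blockEmb h x) ↔ ∀ j, w (blockIndex h (Sum.inr j)) = 0 := by
  constructor
  · rintro ⟨x, rfl⟩ j
    simp [blockEmb]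
  · intro hw
    refine ⟨fun i => w (blockIndex h (Sum.inl i)), ?_⟩
    ext i
    obtain ⟨i, rfl⟩ := (blockIndex h).surjective i
    rcases i with i | i <;> simp [blockEmb, hw]

/-- The lattice `U ∩ ℤⁿ` is saturated, so a basis of it extends to one of `ℤⁿ`; `S` passes to
coordinates in that basis, and invariance of `U` kills the lower left block. -/
theorem exists_blockUpper (A : Matrix (Fin n) (Fin n) ℤ) (U : Submodule ℚ (Fin n → ℚ))
    (hU : ∀ v ∈ U, A.map (Int.cast : ℤ → ℚ) *ᵥ v ∈ U) :
    ∃ (m l : ℕ) (h : m + l = n) (S : GL (Fin n) ℤ) (A' : Matrix (Fin m) (Fin m) ℤ)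
      (C : Matrix (Fin m) (Fin l) ℤ) (A'' : Matrix (Fin l) (Fin l) ℤ),
      (S : Matrix (Fin n) (Fin n) ℤ) * A * ((S⁻¹ : GL (Fin n) ℤ) : Matrix (Fin n) (Fin n) ℤ)
        = blockUpper h A' C A'' ∧
      ∀ v, v ∈ U ↔ ∃ x, (S : Matrix (Fin n) (Fin n) ℤ).map (Int.cast : ℤ → ℚ) *ᵥ v =
        blockEmb h x := by
  let L : Submodule ℤ (Fin n → ℤ) :=
    { carrier := {x | (fun i => (x i : ℚ)) ∈ U}
      zero_mem' := by
        have : (fun _ : Fin n => (0 : ℚ)) ∈ U := U.zero_mem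
        simpa using this
      add_mem' := fun {x y} hx hy => by
        have := U.add_mem hx hy
        simp only [Set.mem_ofPred_eq, Pi.add_apply, Int.cast_add]
        exact this
      smul_mem' := fun c x hx => by
        have := U.smul_mem (c : ℚ) hx
        simp only [Set.mem_ofPred_eq, Pi.smul_apply, smul_eq_mul, Int.cast_mul]
        exact this }
  have memL : ∀ x, x ∈ L ↔ (fun i => (x i : ℚ)) ∈ U := fun x => Iff.rfl
  obtain ⟨m, l, h, b, hb⟩ := exists_basis_of_saturated L (by
    intro a x ha hx
    rw [memL] at hx ⊢
    have := U.smul_mem (a : ℚ)⁻¹ hx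
    convert this using 1
    ext i
    simp [ha])
  let b' := b.reindex (blockIndex h)
  let e := Pi.basisFun ℤ (Fin n)
  let S : GL (Fin n) ℤ := ⟨b'.toMatrix e, e.toMatrix b',
    Module.Basis.toMatrix_mul_toMatrix_flip _ _, Module.Basis.toMatrix_mul_toMatrix_flip _ _⟩
  have hS : ∀ x : Fin n → ℤ, (S : Matrix (Fin n) (Fin n) ℤ) *ᵥ x = b'.repr x := by
    intro x
    exact Module.Basis.toMatrix_mulVec_repr e b' x
  let M : Matrix (Fin n) (Fin n) ℤ := LinearMap.toMatrix b' b' (Matrix.toLin' A)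
  have hM : (S : Matrix (Fin n) (Fin n) ℤ) * A *
      ((S⁻¹ : GL (Fin n) ℤ) : Matrix (Fin n) (Fin n) ℤ) = M := by
    have := basis_toMatrix_mul_linearMap_toMatrix_mul_basis_toMatrix b' e b' e (Matrix.toLin' A)
    rw [← Matrix.toLin_eq_toLin', LinearMap.toMatrix_toLin] at this
    exact this
  let M' := M.submatrix (blockIndex h) (blockIndex h)
  have h21 : M'.toBlocks₂₁ = 0 := by
    ext j i
    change LinearMap.toMatrix b' b' (Matrix.toLin' A) (blockIndex h (Sum.inr j))
      (blockIndex h (Sum.inl i)) = 0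
    rw [LinearMap.toMatrix_apply]
    have h1 : b (Sum.inl i) ∈ L := (hb _).mpr fun j => by simp
    have h2 : A *ᵥ b (Sum.inl i) ∈ L := by
      rw [memL, ← map_intCast_mulVec]
      exact hU _ h1
    have := (hb _).mp h2 j
    simpa [b'] using this
  refine ⟨m, l, h, S, M'.toBlocks₁₁, M'.toBlocks₁₂, M'.toBlocks₂₂, ?_, ?_⟩
  · rw [hM, blockUpper, ← h21, Matrix.fromBlocks_toBlocks]
    ext i j
    simp [M']
  · intro v
    -- Clearing denominators reduces membership in `U` to membership in the lattice.
    obtain ⟨d, y, hd, hy⟩ := exists_int_smul v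
    have hd' : (d : ℚ) ≠ 0 := by exact_mod_cast hd
    have h1 : v ∈ U ↔ y ∈ L := by
      rw [memL, ← hy, U.smul_mem_iff hd']
    rw [h1, hb, exists_eq_blockEmb_iff]
    refine forall_congr' fun j => ?_
    have h2 : (d : ℚ) • ((S : Matrix (Fin n) (Fin n) ℤ).map (Int.cast : ℤ → ℚ) *ᵥ v) =
        fun i => ((b'.repr y i : ℤ) : ℚ) := by
      rw [← Matrix.mulVec_smul, hy, map_intCast_mulVec, hS]
    have h3 := congrFun h2 (blockIndex h (Sum.inr j))
    rw [Pi.smul_apply, smul_eq_mul] at h3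
    have h4 : b'.repr y (blockIndex h (Sum.inr j)) = b.repr y (Sum.inr j) := by
      simp [b']
    rw [h4] at h3
    constructor
    · intro h0
      rw [h0, Int.cast_zero] at h3
      exact (mul_eq_zero.mp h3).resolve_left hd'
    · intro h0
      rw [h0, mul_zero] at h3
      exact_mod_cast h3.symm

end PrimitiveLattice

/-! ### Block triangular matrices on the first coordinates -/

section Blocks

variable {m l n : ℕ} (h : m + l = n)

/-- `blockEmb` as a linear map. -/
def blockEmbLin : (Fin m → ℚ) →ₗ[ℚ] (Fin n → ℚ) where
  toFun := blockEmb h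
  map_add' x y := by
    ext i
    obtain ⟨i, rfl⟩ := (blockIndex h).surjective i
    rcases i with i | i <;> simp [blockEmb]
  map_smul' c x := by
    ext i
    obtain ⟨i, rfl⟩ := (blockIndex h).surjective i
    rcases i with i | i <;> simp [blockEmb]

theorem blockEmb_injective : Function.Injective (blockEmb h) := by
  intro x y hxy
  ext i
  have := congrFun hxy (blockIndex h (Sum.inl i))
  simpa [blockEmb] using this

theorem blockUpper_mulVec_blockEmb (A' : Matrix (Fin m) (Fin m) ℤ)
    (C : Matrix (Fin m) (Fin l) ℤ) (A'' : Matrix (Fin l) (Fin l) ℤ) (x : Fin m → ℚ) :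
    (blockUpper h A' C A'').map (Int.cast : ℤ → ℚ) *ᵥ blockEmb h x =
      blockEmb h (A'.map (Int.cast : ℤ → ℚ) *ᵥ x) := by
  ext i
  obtain ⟨i, rfl⟩ := (blockIndex h).surjective i
  rw [Matrix.mulVec, dotProduct, ← (blockIndex h).sum_comp, Fintype.sum_sum_type]
  rcases i with i | i <;> simp [blockEmb, blockUpper, Matrix.mulVec, dotProduct]

theorem blockUpper_pow_mulVec_blockEmb (A' : Matrix (Fin m) (Fin m) ℤ)
    (C : Matrix (Fin m) (Fin l) ℤ) (A'' : Matrix (Fin l) (Fin l) ℤ) (k : ℕ) (x : Fin m → ℚ) :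
    ((blockUpper h A' C A'').map (Int.cast : ℤ → ℚ)) ^ k *ᵥ blockEmb h x =
      blockEmb h ((A'.map (Int.cast : ℤ → ℚ)) ^ k *ᵥ x) := by
  induction k with
  | zero => simp
  | succ k ih =>
    rw [pow_succ', pow_succ', ← Matrix.mulVec_mulVec, ih, blockUpper_mulVec_blockEmb,
      Matrix.mulVec_mulVec]

theorem charpoly_blockUpper (A' : Matrix (Fin m) (Fin m) ℤ)
    (C : Matrix (Fin m) (Fin l) ℤ) (A'' : Matrix (Fin l) (Fin l) ℤ) :
    (blockUpper h A' C A'').charpoly = A'.charpoly * A''.charpoly := by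
  rw [blockUpper, Matrix.charpoly_reindex, Matrix.charpoly_fromBlocks_zero₂₁]

theorem det_blockUpper (A' : Matrix (Fin m) (Fin m) ℤ)
    (C : Matrix (Fin m) (Fin l) ℤ) (A'' : Matrix (Fin l) (Fin l) ℤ) :
    (blockUpper h A' C A'').det = A'.det * A''.det := by
  rw [blockUpper, Matrix.det_reindex_self, Matrix.det_fromBlocks_zero₂₁]

theorem blockEmb_integral_iff (w : Fin m → ℚ) :
    (∃ y : Fin n → ℤ, blockEmb h w = fun i => (y i : ℚ)) ↔
      ∃ y : Fin m → ℤ, w = fun i => (y i : ℚ) := by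
  constructor
  · rintro ⟨y, hy⟩
    refine ⟨fun i => y (blockIndex h (Sum.inl i)), ?_⟩
    ext i
    have := congrFun hy (blockIndex h (Sum.inl i))
    simpa [blockEmb] using this
  · rintro ⟨y, rfl⟩
    refine ⟨fun i => Sum.elim y (fun _ => 0) ((blockIndex h).symm i), ?_⟩
    ext i
    obtain ⟨i, rfl⟩ := (blockIndex h).surjective i
    rcases i with i | i <;> simp [blockEmb]

end Blocks

/-! ### Rational invariant subspaces give reducibility -/

section Reducible

variable {n : ℕ}

theorem map_intCast_mul {R : Type*} [Ring R] (P Q : Matrix (Fin n) (Fin n) ℤ) :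
    (P * Q).map (Int.cast : ℤ → R) = P.map (Int.cast : ℤ → R) * Q.map (Int.cast : ℤ → R) :=
  map_mul (Int.castRingHom R).mapMatrix P Q

theorem map_intCast_one {R : Type*} [Ring R] :
    (1 : Matrix (Fin n) (Fin n) ℤ).map (Int.cast : ℤ → R) = 1 :=
  map_one (Int.castRingHom R).mapMatrix

theorem map_intCast_mul_inv (S : GL (Fin n) ℤ) :
    (S : Matrix (Fin n) (Fin n) ℤ).map (Int.cast : ℤ → ℚ) *
      ((S⁻¹ : GL (Fin n) ℤ) : Matrix (Fin n) (Fin n) ℤ).map (Int.cast : ℤ → ℚ) = 1 := by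
  rw [← map_intCast_mul, Units.mul_inv, map_intCast_one]

theorem map_intCast_inv_mul (S : GL (Fin n) ℤ) :
    ((S⁻¹ : GL (Fin n) ℤ) : Matrix (Fin n) (Fin n) ℤ).map (Int.cast : ℤ → ℚ) *
      (S : Matrix (Fin n) (Fin n) ℤ).map (Int.cast : ℤ → ℚ) = 1 := by
  rw [← map_intCast_mul, Units.inv_mul, map_intCast_one]

theorem integral_unit_mulVec_iff (S : GL (Fin n) ℤ) (v : Fin n → ℚ) :
    (∃ y : Fin n → ℤ, (S : Matrix (Fin n) (Fin n) ℤ).map (Int.cast : ℤ → ℚ) *ᵥ v =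
      fun i => (y i : ℚ)) ↔ ∃ y : Fin n → ℤ, v = fun i => (y i : ℚ) := by
  constructor
  · rintro ⟨y, hy⟩
    refine ⟨((S⁻¹ : GL (Fin n) ℤ) : Matrix (Fin n) (Fin n) ℤ) *ᵥ y, ?_⟩
    rw [← map_intCast_mulVec, ← hy, Matrix.mulVec_mulVec, map_intCast_inv_mul,
      Matrix.one_mulVec]
  · rintro ⟨y, rfl⟩
    exact ⟨_, map_intCast_mulVec _ _⟩

variable {m l : ℕ} {h : m + l = n} {A : Matrix (Fin n) (Fin n) ℤ} {S : GL (Fin n) ℤ}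
  {A' : Matrix (Fin m) (Fin m) ℤ} {C : Matrix (Fin m) (Fin l) ℤ} {A'' : Matrix (Fin l) (Fin l) ℤ}

theorem charpoly_eq_of_conj_blockUpper (hS : (S : Matrix (Fin n) (Fin n) ℤ) * A *
      ((S⁻¹ : GL (Fin n) ℤ) : Matrix (Fin n) (Fin n) ℤ) = blockUpper h A' C A'') :
    A.charpoly = A'.charpoly * A''.charpoly := by
  rw [← charpoly_blockUpper h A' C A'', ← hS, Matrix.coe_units_inv, Matrix.charpoly_units_conj]

theorem det_ne_zero_of_conj_blockUpper (hA : A.det ≠ 0)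
    (hS : (S : Matrix (Fin n) (Fin n) ℤ) * A *
      ((S⁻¹ : GL (Fin n) ℤ) : Matrix (Fin n) (Fin n) ℤ) = blockUpper h A' C A'') :
    A'.det ≠ 0 := by
  intro h0
  apply hA
  have h1 := congrArg Matrix.det hS
  rw [det_blockUpper, h0, zero_mul, Matrix.det_units_conj] at h1
  exact h1

/-- Membership in either group means integrality after some power of the matrix. The unimodular `S`
preserves integrality and intertwines `A` with the block matrix, which acts as `A'` on the first
coordinates. -/
theorem image_blockEmb_groupSet (hA : A.det ≠ 0)
    (hS : (S : Matrix (Fin n) (Fin n) ℤ) * A *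
      ((S⁻¹ : GL (Fin n) ℤ) : Matrix (Fin n) (Fin n) ℤ) = blockUpper h A' C A'')
    {U : Submodule ℚ (Fin n → ℚ)}
    (hU : ∀ v, v ∈ U ↔ ∃ x, (S : Matrix (Fin n) (Fin n) ℤ).map (Int.cast : ℤ → ℚ) *ᵥ v =
        blockEmb h x) :
    blockEmb h '' groupSet A' =
      (fun v => (S : Matrix (Fin n) (Fin n) ℤ).map (Int.cast : ℤ → ℚ) *ᵥ v) ''
        ((U : Set (Fin n → ℚ)) ∩ groupSet A) := by
  have hA' := det_ne_zero_of_conj_blockUpper hA hS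
  have hpow : ∀ (k : ℕ) (v : Fin n → ℚ),
      ((blockUpper h A' C A'').map (Int.cast : ℤ → ℚ)) ^ k *ᵥ
        ((S : Matrix (Fin n) (Fin n) ℤ).map (Int.cast : ℤ → ℚ) *ᵥ v) =
      (S : Matrix (Fin n) (Fin n) ℤ).map (Int.cast : ℤ → ℚ) *ᵥ
        ((A.map (Int.cast : ℤ → ℚ)) ^ k *ᵥ v) := by
    intro k v
    have e : blockUpper h A' C A'' * (S : Matrix (Fin n) (Fin n) ℤ) =
        (S : Matrix (Fin n) (Fin n) ℤ) * A := by
      rw [← hS, Matrix.mul_assoc, Units.inv_mul, Matrix.mul_one]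
    have e2 : SemiconjBy (S : Matrix (Fin n) (Fin n) ℤ) A (blockUpper h A' C A'') := e.symm
    rw [map_intCast_pow, map_intCast_pow, Matrix.mulVec_mulVec, Matrix.mulVec_mulVec,
      ← map_intCast_mul, ← map_intCast_mul, (e2.pow_right k).eq]
  have key : ∀ (v : Fin n → ℚ) (w : Fin m → ℚ),
      (S : Matrix (Fin n) (Fin n) ℤ).map (Int.cast : ℤ → ℚ) *ᵥ v = blockEmb h w →
      (v ∈ groupSet A ↔ w ∈ groupSet A') := by
    intro v w hvw
    rw [mem_groupSet_iff hA, mem_groupSet_iff hA']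
    refine exists_congr fun k => ?_
    rw [← integral_unit_mulVec_iff S, ← hpow, hvw, blockUpper_pow_mulVec_blockEmb,
      blockEmb_integral_iff]
  ext w
  constructor
  · rintro ⟨x, hx, rfl⟩
    have hv : (S : Matrix (Fin n) (Fin n) ℤ).map (Int.cast : ℤ → ℚ) *ᵥ
        (((S⁻¹ : GL (Fin n) ℤ) : Matrix (Fin n) (Fin n) ℤ).map (Int.cast : ℤ → ℚ) *ᵥ
          blockEmb h x) = blockEmb h x := by
      rw [Matrix.mulVec_mulVec, map_intCast_mul_inv, Matrix.one_mulVec]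
    exact ⟨_, ⟨(hU _).mpr ⟨x, hv⟩, (key _ x hv).mpr hx⟩, hv⟩
  · rintro ⟨v, ⟨hvU, hvA⟩, rfl⟩
    obtain ⟨x, hx⟩ := (hU v).mp hvU
    exact ⟨x, (key v x hx).mp hvA, hx.symm⟩

theorem finrank_eq_of_mem_iff_blockEmb {U : Submodule ℚ (Fin n → ℚ)}
    (hU : ∀ v, v ∈ U ↔ ∃ x, (S : Matrix (Fin n) (Fin n) ℤ).map (Int.cast : ℤ → ℚ) *ᵥ v =
        blockEmb h x) :
    Module.finrank ℚ U = m := by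
  let g : (Fin m → ℚ) →ₗ[ℚ] (Fin n → ℚ) := (Matrix.toLin'
    (((S⁻¹ : GL (Fin n) ℤ) : Matrix (Fin n) (Fin n) ℤ).map (Int.cast : ℤ → ℚ))) ∘ₗ blockEmbLin h
  have hg : ∀ x, (S : Matrix (Fin n) (Fin n) ℤ).map (Int.cast : ℤ → ℚ) *ᵥ g x =
      blockEmb h x := by
    intro x
    change _ *ᵥ (Matrix.toLin' _ (blockEmb h x)) = _
    rw [Matrix.toLin'_apply, Matrix.mulVec_mulVec, map_intCast_mul_inv, Matrix.one_mulVec]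
  have hinj : Function.Injective g := fun x y hxy =>
    blockEmb_injective h (by rw [← hg, ← hg, hxy])
  have hr : LinearMap.range g = U := by
    ext v
    rw [hU, LinearMap.mem_range]
    constructor
    · rintro ⟨x, rfl⟩
      exact ⟨x, hg x⟩
    · rintro ⟨x, hx⟩
      refine ⟨x, ?_⟩
      change Matrix.toLin' _ (blockEmb h x) = v
      rw [← hx, Matrix.toLin'_apply, Matrix.mulVec_mulVec, map_intCast_inv_mul,
        Matrix.one_mulVec]
  rw [← hr, LinearMap.finrank_range_of_inj hinj, Module.finrank_fin_fun]

theorem toLin'_GL_injective (T : GL (Fin n) ℚ) :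
    Function.Injective (Matrix.toLin' (T : Matrix (Fin n) (Fin n) ℚ)) := by
  intro x y hxy
  have := congrArg (fun v => ((T⁻¹ : GL (Fin n) ℚ) : Matrix (Fin n) (Fin n) ℚ) *ᵥ v) hxy
  simpa [Matrix.mulVec_mulVec] using this

/-- Block forms adapted to `U` and to `T(U)` have equal block sizes because `T` preserves dimension.
-/
theorem isReducible_of_invariant {A B : Matrix (Fin n) (Fin n) ℤ} (hA : A.det ≠ 0)
    (hB : B.det ≠ 0) {T : GL (Fin n) ℚ} (hT : IsIso A B T) (U : Submodule ℚ (Fin n → ℚ))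
    (hAU : ∀ v ∈ U, A.map (Int.cast : ℤ → ℚ) *ᵥ v ∈ U)
    (hBU : ∀ v ∈ U.map (Matrix.toLin' (T : Matrix (Fin n) (Fin n) ℚ)),
      B.map (Int.cast : ℤ → ℚ) *ᵥ v ∈ U.map (Matrix.toLin' (T : Matrix (Fin n) (Fin n) ℚ)))
    (hbot : U ≠ ⊥) (htop : U ≠ ⊤) : IsReducible A B T := by
  obtain ⟨m, l, h, S, A', C, A'', hS, hSU⟩ := exists_blockUpper A U hAU
  obtain ⟨m', l', h', L, B', D, B'', hL, hLU⟩ := exists_blockUpper B _ hBU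
  have hm := finrank_eq_of_mem_iff_blockEmb hSU
  have hm' := finrank_eq_of_mem_iff_blockEmb hLU
  rw [LinearEquiv.finrank_eq (Submodule.equivMapOfInjective _ (toLin'_GL_injective T) U).symm,
    hm] at hm'
  subst hm'
  obtain rfl : l = l' := by omega
  have hm0 : m ≠ 0 := by
    rw [← hm]
    exact fun h0 => hbot (Submodule.finrank_eq_zero.mp h0)
  have hl0 : l ≠ 0 := by
    intro h0
    apply htop
    apply Submodule.eq_top_of_finrank_eq
    rw [hm, Module.finrank_fin_fun]
    omega
  refine ⟨S, L, A'.charpoly, A''.charpoly, B'.charpoly, B''.charpoly, ?_, ?_, ?_, ?_,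
    charpoly_eq_of_conj_blockUpper hS, charpoly_eq_of_conj_blockUpper hL,
    m, l, h, A', B', C, D, A'', B'', hS, hL, rfl, rfl, ?_⟩
  · simpa using hm0
  · simpa using hl0
  · simpa using hm0
  · simpa using hl0
  -- Up to `S` and `L` the claim is `T(U ∩ G_A) = T(U) ∩ T(G_A)`, which is injectivity of `T`.
  · rw [image_blockEmb_groupSet hA hS hSU, image_blockEmb_groupSet hB hL hLU, ← hT,
      Submodule.map_coe]
    change _ = _ '' (Matrix.toLin' (T : Matrix (Fin n) (Fin n) ℚ) '' U ∩
      Matrix.toLin' (T : Matrix (Fin n) (Fin n) ℚ) '' groupSet A)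
    rw [← Set.image_inter (toLin'_GL_injective T), ← Set.image_comp, ← Set.image_comp]
    congr 1
    ext v : 1
    simp only [Function.comp_apply, Matrix.toLin'_apply, Matrix.mulVec_mulVec]
    rw [Matrix.mul_assoc, map_intCast_inv_mul, Matrix.mul_one]

end Reducible

/-! ### Factors of the characteristic polynomial and weights -/

section Factorization

variable {K : Type*} [Field K] {n : ℕ} {A : Matrix (Fin n) (Fin n) ℤ}
  {k : ℕ} {h : Fin k → ℤ[X]} {α : Fin k → ℕ}

/-- By Gauss's lemma `f` stays irreducible over `ℚ`, hence is separable in characteristic zero. -/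
theorem nodup_roots_map_of_irreducible [CharZero K] {f : ℤ[X]} (hm : f.Monic) (hf : Irreducible f) :
    (f.map (algebraMap ℤ K)).roots.Nodup := by
  have h1 : Irreducible (f.map (algebraMap ℤ ℚ)) :=
    (hm.irreducible_iff_irreducible_map_fraction_map).mp hf
  have h2 : ((f.map (algebraMap ℤ ℚ)).map (algebraMap ℚ K)).Separable := h1.separable.map
  rw [Polynomial.map_map, ← IsScalarTower.algebraMap_eq] at h2
  exact nodup_roots h2

theorem rootSet_eq_coe_toFinset [DecidableEq K] (f : ℤ[X]) :
    f.rootSet K = ((f.map (algebraMap ℤ K)).roots.toFinset : Set K) := by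
  rw [rootSet_def, aroots_def]

theorem IsFactorization.rootSet_subset (hfac : IsFactorization A.charpoly h α) (i : Fin k) :
    (h i).rootSet K ⊆ eigenvalueSet K A := by
  classical
  intro x hx
  rw [rootSet_eq_coe_toFinset, Finset.mem_coe, Multiset.mem_toFinset,
    mem_roots (((hfac.1 i).map _).ne_zero)] at hx
  rw [mem_eigenvalueSet_iff, mem_roots ((A.charpoly_monic.map _).ne_zero)]
  refine hx.dvd (Polynomial.map_dvd _ ?_)
  rw [hfac.2.2.2.2]
  exact (dvd_pow_self _ (Nat.one_le_iff_ne_zero.mp (hfac.2.2.2.1 i))).trans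
    (Finset.dvd_prod_of_mem _ (Finset.mem_univ i))

theorem rootMultiplicity_prod_pow {R : Type*} [CommRing R] [IsDomain R] {ι : Type*}
    (s : Finset ι) (g : ι → R[X]) (hg : ∀ i, g i ≠ 0) (e : ι → ℕ) (x : R) :
    (∏ i ∈ s, g i ^ e i).rootMultiplicity x = ∑ i ∈ s, e i * (g i).rootMultiplicity x := by
  classical
  simp_rw [← count_roots]
  rw [roots_prod _ _ (Finset.prod_ne_zero_iff.mpr fun i _ => pow_ne_zero _ (hg i)),
    Multiset.count_bind, Finset.sum_map_val]
  simp [roots_pow]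

theorem IsFactorization.rootMultiplicity_map {R : Type*} [CommRing R] [IsDomain R]
    (hfac : IsFactorization A.charpoly h α) (φ : ℤ →+* R) (x : R) :
    (A.charpoly.map φ).rootMultiplicity x =
      ∑ i, α i * ((h i).map φ).rootMultiplicity x := by
  rw [hfac.2.2.2.2, Polynomial.map_prod]
  simp_rw [Polynomial.map_pow]
  exact rootMultiplicity_prod_pow _ _ (fun i => ((hfac.1 i).map φ).ne_zero) _ _

/-- A generalized eigenspace has the algebraic multiplicity as dimension, and each `hᵢ`, having
simple roots, contributes `αᵢ` to it exactly at its own roots. -/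
theorem IsFactorization.weight_eq_finrank [CharZero K] (hfac : IsFactorization A.charpoly h α)
    {M : Set K} (hM : M ⊆ eigenvalueSet K A) :
    weight h α M = Module.finrank K (genEigenspaceSum K A M) := by
  classical
  obtain ⟨M, rfl⟩ := ((finite_eigenvalueSet A).subset hM).exists_finset_coe
  rw [finrank_genEigenspaceSum, weight]
  simp_rw [hfac.rootMultiplicity_map (algebraMap ℤ K)]
  rw [Finset.sum_comm]
  refine Finset.sum_congr rfl fun i _ => ?_
  rw [← Finset.mul_sum]
  congr 1
  have h1 : ∀ x, ((h i).map (algebraMap ℤ K)).rootMultiplicity x =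
      if x ∈ (h i).rootSet K then 1 else 0 := by
    intro x
    rw [← count_roots, rootSet_eq_coe_toFinset,
      Multiset.count_eq_of_nodup (nodup_roots_map_of_irreducible (hfac.1 i) (hfac.2.1 i))]
    simp only [Finset.mem_coe, Multiset.mem_toFinset]
  simp_rw [h1]
  rw [Finset.sum_ite, Finset.sum_const_zero, add_zero, Finset.sum_const, smul_eq_mul, mul_one,
    ← Set.ncard_coe_finset]
  congr 1
  ext x
  simp [part]

theorem IsFactorization.weight_eigenvalueSet [CharZero K] (hfac : IsFactorization A.charpoly h α)
    (hAK : (A.charpoly.map (algebraMap ℤ K)).Splits) :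
    weight h α (eigenvalueSet K A) = n := by
  rw [hfac.weight_eq_finrank subset_rfl, genEigenspaceSum_eigenvalueSet A hAK, finrank_top,
    Module.finrank_fin_fun]

theorem IsFactorization.splits (hfac : IsFactorization A.charpoly h α)
    (hAK : (A.charpoly.map (algebraMap ℤ K)).Splits) (i : Fin k) :
    ((h i).map (algebraMap ℤ K)).Splits := by
  refine Splits.of_dvd hAK ((A.charpoly_monic.map _).ne_zero) (Polynomial.map_dvd _ ?_)
  rw [hfac.2.2.2.2]
  exact (dvd_pow_self _ (Nat.one_le_iff_ne_zero.mp (hfac.2.2.2.1 i))).trans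
    (Finset.dvd_prod_of_mem _ (Finset.mem_univ i))

theorem IsFactorization.numRoots_pos (hfac : IsFactorization A.charpoly h α)
    (hAK : (A.charpoly.map (algebraMap ℤ K)).Splits) (i : Fin k) :
    0 < numRoots K (h i) := by
  classical
  rw [numRoots, Set.ncard_pos (rootSet_finite _ _), rootSet_eq_coe_toFinset]
  have h1 : ((h i).map (algebraMap ℤ K)).roots ≠ 0 := by
    apply (hfac.splits hAK i).roots_ne_zero
    rw [(hfac.1 i).natDegree_map]
    intro h0
    have := (hfac.1 i).natDegree_eq_zero.mp h0
    exact (hfac.2.1 i).not_isUnit (this ▸ isUnit_one)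
  obtain ⟨x, hx⟩ := Multiset.exists_mem_of_ne_zero h1
  exact ⟨x, by simpa using hx⟩

end Factorization

/-! ### Multiplicity of zero modulo `p` -/

section ZeroMultiplicity

variable {K : Type*} [Field K] [NumberField K]

open IsDedekindDomain NumberField

theorem exists_heightOneSpectrum_mem (K : Type*) [Field K] [NumberField K] {p : ℕ}
    (hp : p.Prime) : ∃ P : HeightOneSpectrum (𝓞 K), (p : 𝓞 K) ∈ P.asIdeal := by
  have hne : Ideal.span {(p : 𝓞 K)} ≠ ⊤ := by
    rw [Ne, Ideal.span_singleton_eq_top]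
    intro hu
    have h1 : IsIntegral ℤ ((p : ℚ)⁻¹) := by
      obtain ⟨u, hu⟩ := hu
      have h2 : (algebraMap (𝓞 K) K) (u⁻¹ : (𝓞 K)ˣ) = algebraMap ℚ K (p : ℚ)⁻¹ := by
        have h3 : (algebraMap (𝓞 K) K) u * (algebraMap (𝓞 K) K) (u⁻¹ : (𝓞 K)ˣ) = 1 := by
          rw [← map_mul, Units.mul_inv, map_one]
        rw [hu, map_natCast] at h3
        rw [map_inv₀, map_natCast]
        exact eq_inv_of_mul_eq_one_right h3
      have h3 : IsIntegral ℤ (algebraMap ℚ K (p : ℚ)⁻¹) := by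
        rw [← h2]
        exact RingOfIntegers.isIntegral_coe _
      exact (isIntegral_algebraMap_iff (algebraMap ℚ K).injective).mp h3
    obtain ⟨z, hz⟩ := IsIntegrallyClosed.isIntegral_iff.mp h1
    have h4 : (z : ℚ) * p = 1 := by
      have hp0 : (p : ℚ) ≠ 0 := by exact_mod_cast hp.ne_zero
      rw [eq_intCast] at hz
      rw [hz, inv_mul_cancel₀ hp0]
    have h5 : z * (p : ℤ) = 1 := by exact_mod_cast h4
    exact (Nat.prime_iff_prime_int.mp hp).not_isUnit (IsUnit.of_mul_eq_one_right z h5)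
  obtain ⟨M, hM, hle⟩ := Ideal.exists_le_maximal _ hne
  have hpM : (p : 𝓞 K) ∈ M := hle (Ideal.mem_span_singleton_self _)
  refine ⟨⟨M, hM.isPrime, ?_⟩, hpM⟩
  rintro rfl
  exact hp.ne_zero (by exact_mod_cast (Ideal.mem_bot.mp hpM))

/-- The roots are integral, so `f` splits over the ring of integers and can be reduced modulo `P`
root by root; the roots that become zero are those in `P`. Passing from `ZMod p` to the residue ring
does not change the multiplicity of zero. -/
theorem zeroMult_eq_countP {p : ℕ} (hp : p.Prime) (P : HeightOneSpectrum (𝓞 K))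
    (hP : (p : 𝓞 K) ∈ P.asIdeal) {f : ℤ[X]} (hm : f.Monic)
    (hf : (f.map (algebraMap ℤ K)).Splits) [DecidablePred fun x => P.valuation K x < 1] :
    zeroMult p f = (f.map (algebraMap ℤ K)).roots.countP (fun x => P.valuation K x < 1) := by
  classical
  have : Fact p.Prime := ⟨hp⟩
  set g := f.map (algebraMap ℤ (𝓞 K)) with hg
  have hgm : g.Monic := hm.map _
  have hgK : g.map (algebraMap (𝓞 K) K) = f.map (algebraMap ℤ K) := by
    rw [hg, Polynomial.map_map]
    congr 1
  have hinj : Function.Injective (algebraMap (𝓞 K) K) := FaithfulSMul.algebraMap_injective _ _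
  have hgs : g.Splits := by
    refine Splits.of_splits_map_of_injective hinj (hgK ▸ hf) ?_
    intro a ha
    rw [hgK, mem_roots ((hm.map _).ne_zero)] at ha
    have hint : IsIntegral ℤ a := ⟨f, hm, by rwa [IsRoot.def, eval_map] at ha⟩
    exact ⟨⟨a, hint⟩, rfl⟩
  have hPm := P.isPrime
  have hchar : CharP (𝓞 K ⧸ P.asIdeal) p := by
    rw [CharP.charP_iff_prime_eq_zero hp]
    exact Ideal.Quotient.eq_zero_iff_mem.mpr hP
  let φ : ZMod p →+* 𝓞 K ⧸ P.asIdeal := ZMod.castHom dvd_rfl _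
  have hmap : (f.map (Int.castRingHom (ZMod p))).map φ =
      g.map (Ideal.Quotient.mk P.asIdeal) := by
    rw [hg, Polynomial.map_map, Polynomial.map_map]
    congr 1
    exact RingHom.ext_int _ _
  rw [zeroMult, eq_rootMultiplicity_map φ.injective, map_zero, hmap, ← count_roots,
    hgs.roots_map_of_ne_zero ((hgm.map _).ne_zero), ← hgK, hgs.roots_map_of_injective hinj,
    Multiset.countP_map, Multiset.count, Multiset.countP_map]
  congr 1
  refine Multiset.filter_congr fun x _ => ?_
  rw [eq_comm, Ideal.Quotient.eq_zero_iff_mem, HeightOneSpectrum.valuation_lt_one_iff_mem]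

variable {n : ℕ} {A B : Matrix (Fin n) (Fin n) ℤ} {k : ℕ} {h : Fin k → ℤ[X]} {α : Fin k → ℕ}

theorem IsFactorization.zeroMult_eq_ncard (hfac : IsFactorization A.charpoly h α)
    (hAK : (A.charpoly.map (algebraMap ℤ K)).Splits) {p : ℕ} (hp : p.Prime)
    (P : HeightOneSpectrum (𝓞 K)) (hP : (p : 𝓞 K) ∈ P.asIdeal) (i : Fin k) :
    zeroMult p (h i) = (part (h i) {x ∈ eigenvalueSet K A | P.valuation K x < 1}).ncard := by
  classical
  rw [zeroMult_eq_countP hp P hP (hfac.1 i) (hfac.splits hAK i), Multiset.countP_eq_card_filter,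
    ← Multiset.toFinset_card_of_nodup
      ((nodup_roots_map_of_irreducible (hfac.1 i) (hfac.2.1 i)).filter _),
    ← Set.ncard_coe_finset]
  congr 1
  ext x
  have : x ∈ (h i).rootSet K → x ∈ eigenvalueSet K A := fun hx => hfac.rootSet_subset i hx
  simp only [part, Multiset.toFinset_filter, Finset.coe_filter, Multiset.mem_toFinset,
    rootSet_eq_coe_toFinset, Set.mem_inter_iff, Finset.mem_coe, Set.mem_ofPred_eq] at this ⊢
  tauto

theorem IsFactorization.zeroMult_charpoly (hfac : IsFactorization A.charpoly h α) {p : ℕ}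
    (hp : p.Prime) : zeroMult p A.charpoly = ∑ i, α i * zeroMult p (h i) := by
  have : Fact p.Prime := ⟨hp⟩
  exact hfac.rootMultiplicity_map _ _

/-- The determinant is, up to sign, the constant coefficient, and a monic polynomial of degree `n`
divisible by `Xⁿ` is `Xⁿ`. Thus `t_p` alone decides whether a prime `p` lies in `𝒫'`. -/
theorem mem_primeSet_iff {p : ℕ} :
    p ∈ primeSet A ↔ p.Prime ∧ 0 < zeroMult p A.charpoly ∧ zeroMult p A.charpoly ≠ n := by
  rw [primeSet, Set.mem_ofPred_eq]
  refine and_congr_right fun hp => ?_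
  have : Fact p.Prime := ⟨hp⟩
  set f := A.charpoly.map (Int.castRingHom (ZMod p)) with hf
  have hfm : f.Monic := A.charpoly_monic.map _
  refine and_congr ?_ (not_congr ?_)
  · rw [zeroMult, rootMultiplicity_pos hfm.ne_zero, IsRoot.def, ← coeff_zero_eq_eval_zero,
      coeff_map, Matrix.det_eq_sign_charpoly_coeff, eq_intCast, ZMod.intCast_zmod_eq_zero_iff_dvd]
    exact (Int.isUnit_iff.mpr (neg_one_pow_eq_or ℤ _)).dvd_mul_left
  · have hdeg : f.natDegree = n := by
      rw [A.charpoly_monic.natDegree_map, Matrix.charpoly_natDegree_eq_dim, Fintype.card_fin]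
    constructor
    · intro h1
      rw [zeroMult, ← hf, h1]
      simpa using rootMultiplicity_X_sub_C_pow (0 : ZMod p) n
    · intro h1
      have h2 := pow_rootMultiplicity_dvd f 0
      rw [show f.rootMultiplicity 0 = n from h1, C_0, sub_zero] at h2
      exact (eq_of_monic_of_dvd_of_natDegree_le (monic_X_pow n) hfm h2
        (by rw [hdeg, natDegree_X_pow]))

end ZeroMultiplicity

/-! ### Corresponding sets of eigenvalues and minimality -/

section Correspondence

variable {K : Type*} [Field K] [Algebra ℚ K] {n : ℕ} {A B : Matrix (Fin n) (Fin n) ℤ}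
  {T : GL (Fin n) ℚ} {M M' N N' : Set K}

variable (K) in
/-- `T` acting on `Kⁿ`. -/
noncomputable abbrev extendScalars (T : GL (Fin n) ℚ) : (Fin n → K) →ₗ[K] (Fin n → K) :=
  Matrix.toLin' ((T : Matrix (Fin n) (Fin n) ℚ).map (algebraMap ℚ K))

theorem extendScalars_injective : Function.Injective (extendScalars K T) := fun x y hxy => by
  rw [← toLin'_inv_comp T x, ← toLin'_inv_comp T y]
  exact congrArg _ hxy

theorem extendScalars_comp_inv (T : GL (Fin n) ℚ) (x : Fin n → K) :
    extendScalars K T (extendScalars K T⁻¹ x) = x := by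
  have := toLin'_inv_comp T⁻¹ x
  rwa [inv_inv] at this

theorem Corresponds.symm (h : Corresponds K A B T M M') : Corresponds K B A T⁻¹ M' M := by
  refine ⟨h.2.1, h.1, ?_⟩
  rw [← h.2.2, ← Submodule.map_comp]
  convert Submodule.map_id _
  ext1 x
  exact LinearMap.ext fun y => toLin'_inv_comp T _

theorem Corresponds.inter (h : Corresponds K A B T M M') (h' : Corresponds K A B T N N') :
    Corresponds K A B T (M ∩ N) (M' ∩ N') := by
  refine ⟨Set.inter_subset_left.trans h.1, Set.inter_subset_left.trans h.2.1, ?_⟩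
  rw [genEigenspaceSum_inter, genEigenspaceSum_inter, ← h.2.2, ← h'.2.2,
    Submodule.map_inf _ extendScalars_injective]

theorem Corresponds.iUnion {ι : Sort*} {M M' : ι → Set K}
    (h : ∀ i, Corresponds K A B T (M i) (M' i)) :
    Corresponds K A B T (⋃ i, M i) (⋃ i, M' i) := by
  refine ⟨Set.iUnion_subset fun i => (h i).1, Set.iUnion_subset fun i => (h i).2.1, ?_⟩
  rw [genEigenspaceSum_iUnion, genEigenspaceSum_iUnion, Submodule.map_iSup]
  exact iSup_congr fun i => (h i).2.2

theorem Corresponds.right_unique (h : Corresponds K A B T M M') (h' : Corresponds K A B T M N') :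
    M' = N' :=
  genEigenspaceSum_injOn B h.2.1 h'.2.1 (h.2.2.symm.trans h'.2.2)

theorem Corresponds.left_unique (h : Corresponds K A B T M M') (h' : Corresponds K A B T N M') :
    M = N :=
  h.symm.right_unique h'.symm

theorem corresponds_empty : Corresponds K A B T ∅ ∅ :=
  ⟨Set.empty_subset _, Set.empty_subset _, by
    rw [genEigenspaceSum_empty, genEigenspaceSum_empty, Submodule.map_bot]⟩

theorem Corresponds.nonempty_right (h : Corresponds K A B T M M') (hM : M.Nonempty) :
    M'.Nonempty := by
  rw [Set.nonempty_iff_ne_empty] at hM ⊢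
  rintro rfl
  exact hM (h.left_unique corresponds_empty)

theorem corresponds_eigenvalueSet (hAK : (A.charpoly.map (algebraMap ℤ K)).Splits)
    (hBK : (B.charpoly.map (algebraMap ℤ K)).Splits) :
    Corresponds K A B T (eigenvalueSet K A) (eigenvalueSet K B) := by
  refine ⟨subset_rfl, subset_rfl, ?_⟩
  rw [genEigenspaceSum_eigenvalueSet A hAK, genEigenspaceSum_eigenvalueSet B hBK,
    Submodule.map_top, LinearMap.range_eq_top]
  exact fun x => ⟨_, extendScalars_comp_inv T x⟩

theorem Corresponds.finrank_eq (h : Corresponds K A B T M M') :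
    Module.finrank K (genEigenspaceSum K A M) = Module.finrank K (genEigenspaceSum K B M') := by
  rw [← h.2.2]
  exact (Submodule.equivMapOfInjective _ extendScalars_injective _).finrank_eq

theorem coordMap_extendScalars (σ : K ≃ₐ[ℚ] K) (v : Fin n → K) :
    coordMap (σ : K ≃+* K) n (extendScalars K T v) =
      extendScalars K T (coordMap (σ : K ≃+* K) n v) := by
  simp only [extendScalars, Matrix.toLin'_apply]
  apply coordMap_mulVec
  ext; simp

/-- The rational matrix `T` commutes with the coordinatewise action of `σ`. -/
theorem Corresponds.image (h : Corresponds K A B T M M') (σ : K ≃ₐ[ℚ] K) :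
    Corresponds K A B T (σ '' M) (σ '' M') := by
  refine ⟨image_subset_eigenvalueSet A (σ : K ≃+* K) h.1,
    image_subset_eigenvalueSet B (σ : K ≃+* K) h.2.1, ?_⟩
  have hinv : ∀ v : Fin n → K,
      coordMap (σ : K ≃+* K) n (coordMap (σ.symm : K ≃+* K) n v) = v := fun v =>
    funext fun i => σ.apply_symm_apply (v i)
  apply le_antisymm
  · rintro _ ⟨x, hx, rfl⟩
    rw [SetLike.mem_coe, ← hinv x] at hx
    rw [← hinv x]
    change extendScalars K T _ ∈ _
    rw [← coordMap_extendScalars]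
    refine (coordMap_mem_genEigenspaceSum_iff B (σ : K ≃+* K) M' _).mpr ?_
    rw [← h.2.2]
    exact ⟨_, (coordMap_mem_genEigenspaceSum_iff A (σ : K ≃+* K) M _).mp hx, rfl⟩
  · intro y hy
    rw [← hinv y] at hy
    have h1 := (coordMap_mem_genEigenspaceSum_iff B (σ : K ≃+* K) M' _).mp hy
    rw [← h.2.2] at h1
    obtain ⟨x, hx, hxy⟩ := h1
    refine ⟨coordMap (σ : K ≃+* K) n x,
      (coordMap_mem_genEigenspaceSum_iff A (σ : K ≃+* K) M _).mpr hx, ?_⟩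
    change extendScalars K T _ = _
    rw [← coordMap_extendScalars, ← hinv y]
    exact congrArg _ hxy

/-- `S` is non-empty and minimal with respect to inclusion among the non-empty sets `N` that
correspond to some `N'`, and `S'` corresponds to `S`. -/
def MinimalPair (A B : Matrix (Fin n) (Fin n) ℤ) (T : GL (Fin n) ℚ) (S S' : Set K) : Prop :=
  S.Nonempty ∧ Corresponds K A B T S S' ∧
    ∀ N N' : Set K, Corresponds K A B T N N' → N.Nonempty → N ⊆ S → N = S

theorem IsSmallest.minimalPair {S S' : Set K} (hS : IsSmallest K A B T S)
    (hSS' : Corresponds K A B T S S') : MinimalPair A B T S S' :=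
  ⟨hS.1, hSS', fun N N' h hN hNS => Set.eq_of_subset_of_ncard_le hNS (hS.2.2 N hN ⟨N', h⟩)
    ((finite_eigenvalueSet A).subset hSS'.1)⟩

/-- The reason for using minimality under inclusion: it passes to `S'`, whereas correspondence
preserves dimensions but need not visibly preserve cardinalities. -/
theorem MinimalPair.symm {S S' : Set K} (h : MinimalPair A B T S S') :
    MinimalPair B A T⁻¹ S' S := by
  refine ⟨h.2.1.nonempty_right h.1, h.2.1.symm, fun N' N hN hne hsub => ?_⟩
  have h1 : Corresponds K A B T N N' := by simpa using hN.symm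
  have h2 := h1.inter h.2.1
  rw [Set.inter_eq_left.mpr hsub] at h2
  have h3 := h.2.2 _ _ h2 (h2.symm.nonempty_right hne) Set.inter_subset_right
  rw [h3] at h2
  exact h2.right_unique h.2.1

/-- The set `S ∩ σ⁻¹M` again corresponds to some set, so minimality makes it empty or all of `S`. -/
theorem MinimalPair.image_subset_or_disjoint {S S' : Set K} (h : MinimalPair A B T S S')
    (hM : Corresponds K A B T M M') (σ : K ≃ₐ[ℚ] K) : σ '' S ⊆ M ∨ Disjoint (σ '' S) M := by
  by_cases hne : (S ∩ σ.symm '' M).Nonempty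
  · left
    have := h.2.2 _ _ (h.2.1.inter (hM.image σ.symm)) hne Set.inter_subset_left
    rintro _ ⟨x, hx, rfl⟩
    rw [← this] at hx
    obtain ⟨y, hy, rfl⟩ := hx.2
    simpa using hy
  · right
    rw [Set.disjoint_left]
    rintro _ ⟨x, hx, rfl⟩ hxM
    exact hne ⟨x, hx, σ x, hxM, by simp⟩

theorem part_image (σ : K ≃ₐ[ℚ] K) (f : ℤ[X]) (M : Set K) :
    part f (σ '' M) = σ '' part f M := by
  have : CharZero K := algebraRat.charZero K
  have hroot : ∀ x, σ x ∈ f.rootSet K ↔ x ∈ f.rootSet K := by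
    intro x
    by_cases hf : f = 0
    · simp [hf]
    · rw [mem_rootSet_of_ne hf, mem_rootSet_of_ne hf]
      have := Polynomial.aeval_algHom_apply (σ.toAlgHom.restrictScalars ℤ) x f
      have h2 : aeval (σ x) f = σ (aeval x f) := this
      rw [h2, map_eq_zero_iff _ σ.injective]
  ext y
  constructor
  · rintro ⟨⟨x, hx, rfl⟩, hr⟩
    exact ⟨x, ⟨hx, (hroot x).mp hr⟩, rfl⟩
  · rintro ⟨x, ⟨hx, hr⟩, rfl⟩
    exact ⟨⟨x, hx, rfl⟩, (hroot x).mpr hr⟩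

/-- A set that corresponds to some set is a disjoint union of Galois translates of a minimal
set `S`, provided that it is covered by the translates. -/
theorem MinimalPair.exists_ncard_part_eq_mul [FiniteDimensional ℚ K] {S S' : Set K}
    (h : MinimalPair A B T S S') (hM : Corresponds K A B T M M')
    (hcov : M ⊆ ⋃ σ : K ≃ₐ[ℚ] K, σ '' S) :
    ∃ c : ℕ, ∀ f : ℤ[X], (part f M).ncard = c * (part f S).ncard := by
  classical
  have hfin : S.Finite := (finite_eigenvalueSet A).subset h.2.1.1
  obtain ⟨s, hs⟩ := hfin.exists_finset_coe
  -- The distinct translates of `S` inside `M`, each counted once although several `σ` may give it.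
  -- Their number does not involve `f`, so one constant serves all factors.
  let O : Finset (Finset K) := (Finset.univ.image fun σ : K ≃ₐ[ℚ] K => s.image σ).filter
    fun t => (t : Set K) ⊆ M
  refine ⟨O.card, fun f => ?_⟩
  have hO : ∀ t ∈ O, ∃ σ : K ≃ₐ[ℚ] K, (t : Set K) = σ '' S ∧ (t : Set K) ⊆ M := by
    intro t ht
    rw [Finset.mem_filter, Finset.mem_image] at ht
    obtain ⟨⟨σ, -, rfl⟩, ht⟩ := ht
    exact ⟨σ, by simp [hs], ht⟩
  have hunion : part f M = ((O.biUnion fun t => t.filter (· ∈ f.rootSet K) : Finset K) : Set K) := by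
    ext x
    rw [Finset.mem_coe, Finset.mem_biUnion]
    constructor
    · rintro ⟨hxM, hxr⟩
      obtain ⟨σ, hσ⟩ := Set.mem_iUnion.mp (hcov hxM)
      refine ⟨s.image σ, ?_, ?_⟩
      · rw [Finset.mem_filter]
        refine ⟨Finset.mem_image_of_mem _ (Finset.mem_univ σ), ?_⟩
        rw [Finset.coe_image, hs]
        exact (h.image_subset_or_disjoint hM σ).resolve_right
          fun hd => Set.disjoint_left.mp hd hσ hxM
      · rw [Finset.mem_filter, ← Finset.mem_coe, Finset.coe_image, hs]
        exact ⟨hσ, hxr⟩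
    · rintro ⟨t, ht, hxt⟩
      rw [Finset.mem_filter] at hxt
      obtain ⟨σ, -, htM⟩ := hO t ht
      exact ⟨htM hxt.1, hxt.2⟩
  rw [hunion, Set.ncard_coe_finset, Finset.card_biUnion, Finset.sum_const_nat]
  · intro t ht
    obtain ⟨σ, hσ, -⟩ := hO t ht
    rw [← Set.ncard_coe_finset, ← Set.ncard_image_of_injective (part f S) σ.injective, ← part_image, ← hσ]
    congr 1
    ext x
    simp [part]
  -- Two translates that meet contain each other, by the dichotomy applied both ways.
  · intro t ht u hu htu
    obtain ⟨σ, hσ, -⟩ := hO t ht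
    obtain ⟨τ, hτ, -⟩ := hO u hu
    have hd : Disjoint (t : Set K) (u : Set K) := by
      rw [hσ, hτ]
      rcases h.image_subset_or_disjoint (h.2.1.image τ) σ with h1 | h1
      · rcases h.image_subset_or_disjoint (h.2.1.image σ) τ with h2 | h2
        · exact absurd (Finset.coe_injective ((hσ.trans (h1.antisymm h2)).trans hτ.symm)) htu
        · exact h2.symm
      · exact h1
    exact (Finset.disjoint_coe.mp hd).mono (Finset.filter_subset _ _) (Finset.filter_subset _ _)

end Correspondence

/-! ### Galois descent and covering by translates -/

section Descent

variable {K : Type*} [Field K] [NumberField K] {n : ℕ}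
  {A B : Matrix (Fin n) (Fin n) ℤ} {T : GL (Fin n) ℚ} {M M' : Set K}

/-- The rational vectors of a subspace of `Kⁿ`. -/
def rationalPart (U : Submodule K (Fin n → K)) : Submodule ℚ (Fin n → ℚ) where
  carrier := {v | (fun i => algebraMap ℚ K (v i)) ∈ U}
  zero_mem' := by
    have : (fun _ : Fin n => (0 : K)) ∈ U := U.zero_mem
    simpa using this
  add_mem' {x y} hx hy := by
    have := U.add_mem hx hy
    simp only [Set.mem_ofPred_eq, Pi.add_apply, map_add]
    exact this
  smul_mem' c x hx := by
    have := U.smul_mem (algebraMap ℚ K c) hx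
    simp only [Set.mem_ofPred_eq, Pi.smul_apply, smul_eq_mul, map_mul]
    exact this

theorem mem_rationalPart {U : Submodule K (Fin n → K)} {v : Fin n → ℚ} :
    v ∈ rationalPart U ↔ (fun i => algebraMap ℚ K (v i)) ∈ U := Iff.rfl

theorem algebraMap_mulVec (P : Matrix (Fin n) (Fin n) ℚ) (v : Fin n → ℚ) :
    (fun i => algebraMap ℚ K ((P *ᵥ v) i)) =
      P.map (algebraMap ℚ K) *ᵥ fun i => algebraMap ℚ K (v i) := by
  ext i
  simp [Matrix.mulVec, dotProduct]

theorem map_rationalPart (U : Submodule K (Fin n → K)) :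
    (rationalPart U).map (Matrix.toLin' (T : Matrix (Fin n) (Fin n) ℚ)) =
      rationalPart (U.map (extendScalars K T)) := by
  ext v
  constructor
  · rintro ⟨x, hx, rfl⟩
    refine ⟨_, hx, ?_⟩
    rw [Matrix.toLin'_apply, Matrix.toLin'_apply, algebraMap_mulVec]
  · rintro ⟨x, hx, hxv⟩
    refine ⟨((T⁻¹ : GL (Fin n) ℚ) : Matrix (Fin n) (Fin n) ℚ) *ᵥ v, ?_, ?_⟩
    · change (fun i => algebraMap ℚ K _) ∈ U
      rw [algebraMap_mulVec, ← hxv, ← Matrix.toLin'_apply]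
      rwa [toLin'_inv_comp]
    · rw [Matrix.toLin'_apply, Matrix.mulVec_mulVec, Units.mul_inv, Matrix.one_mulVec]

theorem rationalPart_genEigenspaceSum_invariant (A : Matrix (Fin n) (Fin n) ℤ) (M : Set K)
    (v : Fin n → ℚ) (hv : v ∈ rationalPart (genEigenspaceSum K A M)) :
    A.map (Int.cast : ℤ → ℚ) *ᵥ v ∈ rationalPart (genEigenspaceSum K A M) := by
  rw [mem_rationalPart, algebraMap_mulVec, map_intCast_map_algebraMap]
  exact genEigenspaceSum_invariant A M hv

/-- Scale a nonzero vector so that one coordinate is `1` and sum its Galois conjugates: the result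
is rational, lies in `U`, and has the nonzero number `[K : ℚ]` as that coordinate. -/
theorem rationalPart_ne_bot [IsGalois ℚ K] {U : Submodule K (Fin n → K)} (hU : U ≠ ⊥)
    (hstab : ∀ (σ : K ≃ₐ[ℚ] K), ∀ v ∈ U, coordMap (σ : K ≃+* K) n v ∈ U) :
    rationalPart U ≠ ⊥ := by
  obtain ⟨v, hv, hv0⟩ := U.ne_bot_iff.mp hU
  obtain ⟨j, hj⟩ := Function.ne_iff.mp hv0
  let w : Fin n → ℚ := fun i => Algebra.trace ℚ K ((v j)⁻¹ * v i)
  have hw : w ∈ rationalPart U := by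
    rw [mem_rationalPart]
    have e : (fun i => algebraMap ℚ K (w i)) =
        ∑ σ : K ≃ₐ[ℚ] K, coordMap (σ : K ≃+* K) n ((v j)⁻¹ • v) := by
      ext i
      rw [Finset.sum_apply, trace_eq_sum_automorphisms]
      rfl
    rw [e]
    exact U.sum_mem fun σ _ => hstab σ _ (U.smul_mem _ hv)
  refine (Submodule.ne_bot_iff _).mpr ⟨w, hw, fun h0 => ?_⟩
  have h1 := congrFun h0 j
  simp only [w, Pi.zero_apply] at hj h1
  rw [inv_mul_cancel₀ hj, ← map_one (algebraMap ℚ K), Algebra.trace_algebraMap] at h1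
  simp at h1
  exact Module.finrank_pos.ne' h1

theorem eq_top_of_rationalPart_eq_top {U : Submodule K (Fin n → K)} (hU : rationalPart U = ⊤) :
    U = ⊤ := by
  rw [eq_top_iff, ← (Pi.basisFun K (Fin n)).span_eq, Submodule.span_le]
  rintro _ ⟨j, rfl⟩
  have h1 : (Pi.single j 1 : Fin n → ℚ) ∈ rationalPart U := hU ▸ Submodule.mem_top
  rw [mem_rationalPart] at h1
  have e : Pi.basisFun K (Fin n) j = fun i => algebraMap ℚ K ((Pi.single j 1 : Fin n → ℚ) i) := by
    ext i
    by_cases hij : i = j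
    · subst hij; simp
    · simp [hij]
  rwa [SetLike.mem_coe, e]

/-- The only use of irreducibility: a smaller union of translates would descend to a proper nonzero
rational subspace, invariant under `A` and with `B`-invariant image. -/
theorem MinimalPair.iUnion_image_eq [IsGalois ℚ K] (hA : A.det ≠ 0) (hB : B.det ≠ 0)
    (hAK : (A.charpoly.map (algebraMap ℤ K)).Splits)
    (hT : IsIrreducibleIso A B T) {S S' : Set K} (h : MinimalPair A B T S S') :
    ⋃ σ : K ≃ₐ[ℚ] K, σ '' S = eigenvalueSet K A := by
  set W := ⋃ σ : K ≃ₐ[ℚ] K, σ '' S with hW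
  have hcor : Corresponds K A B T W (⋃ σ : K ≃ₐ[ℚ] K, σ '' S') :=
    Corresponds.iUnion fun σ => h.2.1.image σ
  have hWσ : ∀ σ : K ≃ₐ[ℚ] K, (σ : K ≃+* K) '' W ⊆ W := by
    rintro σ _ ⟨x, hx, rfl⟩
    obtain ⟨τ, y, hy, rfl⟩ := Set.mem_iUnion.mp hx
    exact Set.mem_iUnion.mpr ⟨τ.trans σ, y, hy, rfl⟩
  by_contra hne
  apply hT.2
  apply isReducible_of_invariant hA hB hT.1 (rationalPart (genEigenspaceSum K A W))
  · exact rationalPart_genEigenspaceSum_invariant A W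
  · rw [map_rationalPart, hcor.2.2]
    exact rationalPart_genEigenspaceSum_invariant B _
  · apply rationalPart_ne_bot
    · intro h0
      obtain ⟨x, hx⟩ := h.1
      have hxW : x ∈ W := Set.mem_iUnion.mpr ⟨AlgEquiv.refl, x, hx, rfl⟩
      have := maxGenEigenspace_le_genEigenspaceSum A hxW
      rw [h0] at this
      exact maxGenEigenspace_ne_bot A (h.2.1.1 hx) (le_bot_iff.mp this)
    · exact fun σ v hv => genEigenspaceSum_mono A (hWσ σ)
        ((coordMap_mem_genEigenspaceSum_iff A (σ : K ≃+* K) W v).mpr hv)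
  · intro h0
    apply hne
    apply genEigenspaceSum_injOn A hcor.1 subset_rfl
    rw [genEigenspaceSum_eigenvalueSet A hAK]
    exact eq_top_of_rationalPart_eq_top h0

end Descent

/-! ### Counting translates -/

section Divisibility

variable {K : Type*} [Field K] [NumberField K] {n : ℕ}
  {A B : Matrix (Fin n) (Fin n) ℤ} {T : GL (Fin n) ℚ} {S S' : Set K}
  {k : ℕ} {h : Fin k → ℤ[X]} {α : Fin k → ℕ}

open IsDedekindDomain NumberField

theorem IsIso.corresponds_prime (hA : A.det ≠ 0) (hB : B.det ≠ 0)
    (hAK : (A.charpoly.map (algebraMap ℤ K)).Splits)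
    (hBK : (B.charpoly.map (algebraMap ℤ K)).Splits) (hT : IsIso A B T)
    (P : HeightOneSpectrum (𝓞 K)) :
    Corresponds K A B T {a ∈ eigenvalueSet K A | P.valuation K a < 1}
      {a ∈ eigenvalueSet K B | P.valuation K a < 1} := by
  refine hT.corresponds_valuation _ hA hB ?_ hAK hBK
  obtain ⟨π, hπ⟩ := P.valuation_exists_uniformizer K
  refine ⟨π⁻¹, ?_⟩
  rw [map_inv₀, hπ, ← WithZero.exp_neg, neg_neg, ← WithZero.exp_zero, WithZero.exp_lt_exp]
  exact zero_lt_one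

theorem IsFactorization.zeroMult_charpoly_eq_finrank (hfac : IsFactorization A.charpoly h α)
    (hAK : (A.charpoly.map (algebraMap ℤ K)).Splits) {p : ℕ} (hp : p.Prime)
    (P : HeightOneSpectrum (𝓞 K)) (hP : (p : 𝓞 K) ∈ P.asIdeal) :
    zeroMult p A.charpoly = Module.finrank K
      (genEigenspaceSum K A {a ∈ eigenvalueSet K A | P.valuation K a < 1}) := by
  rw [← hfac.weight_eq_finrank fun _ h => h.1, hfac.zeroMult_charpoly hp, weight]
  exact Finset.sum_congr rfl fun i _ => by rw [hfac.zeroMult_eq_ncard hAK hp P hP]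

/-- Both quotients in each identity count translates of `S`: `c` of them make up the whole spectrum,
and `d` of them the eigenvalues in a prime above `p`. -/
theorem MinimalPair.divisibility (hA : A.det ≠ 0) (hB : B.det ≠ 0)
    (hAK : (A.charpoly.map (algebraMap ℤ K)).Splits)
    (hBK : (B.charpoly.map (algebraMap ℤ K)).Splits) (hfac : IsFactorization A.charpoly h α)
    (hT : IsIso A B T) (hmin : MinimalPair A B T S S')
    (hcov : ⋃ σ : K ≃ₐ[ℚ] K, σ '' S = eigenvalueSet K A) :
    (∀ i, (part (h i) S).Nonempty) ∧ weight h α S ∣ n ∧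
      (∀ p ∈ primeSet A, weight h α S ∣ zeroMult p A.charpoly) ∧
      ∀ i, (part (h i) S).ncard ∣ numRoots K (h i) ∧
        (numRoots K (h i) : ℚ) / (part (h i) S).ncard = (n : ℚ) / weight h α S ∧
        ∀ p ∈ primeSet A, (part (h i) S).ncard ∣ zeroMult p (h i) ∧
          (zeroMult p (h i) : ℚ) / (part (h i) S).ncard
            = (zeroMult p A.charpoly : ℚ) / weight h α S := by
  obtain ⟨c, hc⟩ := hmin.exists_ncard_part_eq_mul (corresponds_eigenvalueSet hAK hBK) hcov.ge
  have hroots : ∀ i, numRoots K (h i) = c * (part (h i) S).ncard := fun i => by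
    rw [← hc, part, Set.inter_eq_right.mpr (hfac.rootSet_subset i), numRoots]
  have hn : n = c * weight h α S := by
    rw [← hfac.weight_eigenvalueSet hAK, weight, weight, Finset.mul_sum]
    exact Finset.sum_congr rfl fun i _ => by rw [hc, mul_left_comm]
  have hprime : ∀ p ∈ primeSet A, ∃ d, (∀ i, zeroMult p (h i) = d * (part (h i) S).ncard) ∧
      zeroMult p A.charpoly = d * weight h α S := by
    intro p hp
    obtain ⟨P, hP⟩ := exists_heightOneSpectrum_mem K hp.1
    have hcor := hT.corresponds_prime hA hB hAK hBK P
    obtain ⟨d, hd⟩ := hmin.exists_ncard_part_eq_mul hcor (hcov ▸ hcor.1)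
    have hd' : ∀ i, zeroMult p (h i) = d * (part (h i) S).ncard := fun i => by
      rw [hfac.zeroMult_eq_ncard hAK hp.1 P hP, hd]
    refine ⟨d, hd', ?_⟩
    rw [hfac.zeroMult_charpoly hp.1, weight, Finset.mul_sum]
    exact Finset.sum_congr rfl fun i _ => by rw [hd', mul_left_comm]
  have hpos : ∀ i, 0 < (part (h i) S).ncard := fun i =>
    pos_of_mul_pos_right (hroots i ▸ hfac.numRoots_pos hAK i) c.zero_le
  have hne : ∀ i, ((part (h i) S).ncard : ℚ) ≠ 0 := fun i => by exact_mod_cast (hpos i).ne'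
  -- An index is required, since the weight is an empty sum when `k = 0`.
  have hwne : Fin k → (weight h α S : ℚ) ≠ 0 := fun i => by
    have h1 : 0 < weight h α S := Finset.sum_pos'
      (fun _ _ => Nat.zero_le _)
      ⟨i, Finset.mem_univ i, Nat.mul_pos (hfac.2.2.2.1 i) (hpos i)⟩
    exact_mod_cast h1.ne'
  refine ⟨fun i => Set.nonempty_of_ncard_ne_zero (hpos i).ne',
    Dvd.intro_left c hn.symm, fun p hp => ?_, fun i =>
      ⟨Dvd.intro_left c (hroots i).symm, ?_, fun p hp => ?_⟩⟩
  · obtain ⟨d, -, hd⟩ := hprime p hp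
    exact Dvd.intro_left d hd.symm
  · rw [hroots, Nat.cast_mul, mul_div_cancel_right₀ _ (hne i)]
    conv_rhs => rw [hn, Nat.cast_mul, mul_div_cancel_right₀ _ (hwne i)]
  · obtain ⟨d, hd, hd'⟩ := hprime p hp
    refine ⟨Dvd.intro_left d (hd i).symm, ?_⟩
    rw [hd, hd', Nat.cast_mul, Nat.cast_mul, mul_div_cancel_right₀ _ (hne i),
      mul_div_cancel_right₀ _ (hwne i)]

end Divisibility

end Solenoid

theorem lemma5p5 {n : ℕ} (A B : Matrix (Fin n) (Fin n) ℤ) (hA : A.det ≠ 0) (hB : B.det ≠ 0)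
    (K : Type*) [Field K] [NumberField K] [IsGalois ℚ K]
    (hAK : (A.charpoly.map (algebraMap ℤ K)).Splits)
    (hBK : (B.charpoly.map (algebraMap ℤ K)).Splits)
    {k s : ℕ} (h : Fin k → ℤ[X]) (α : Fin k → ℕ) (r : Fin s → ℤ[X]) (β : Fin s → ℕ)
    (hfac : Solenoid.IsFactorization A.charpoly h α)
    (rfac : Solenoid.IsFactorization B.charpoly r β)
    (T : GL (Fin n) ℚ) (hT : Solenoid.IsIrreducibleIso A B T)
    (S S' : Set K) (hS : Solenoid.IsSmallest K A B T S)
    (hSS' : Solenoid.Corresponds K A B T S S') :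
    (∀ i, (Solenoid.part (h i) S).Nonempty) ∧
    (∀ j, (Solenoid.part (r j) S').Nonempty) ∧
    Solenoid.weight h α S = Solenoid.weight r β S' ∧
    -- the set `𝒫'` and the numbers `t_p` are the same for `A` and `B`
    Solenoid.primeSet A = Solenoid.primeSet B ∧
    (∀ p ∈ Solenoid.primeSet A,
      Solenoid.zeroMult p A.charpoly = Solenoid.zeroMult p B.charpoly) ∧
    -- the assertions for `A`
    (Solenoid.weight h α S ∣ n ∧
      (∀ p ∈ Solenoid.primeSet A, Solenoid.weight h α S ∣ Solenoid.zeroMult p A.charpoly) ∧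
      ∀ i,
        (Solenoid.part (h i) S).ncard ∣ Solenoid.numRoots K (h i) ∧
        (Solenoid.numRoots K (h i) : ℚ) / (Solenoid.part (h i) S).ncard
          = (n : ℚ) / Solenoid.weight h α S ∧
        ∀ p ∈ Solenoid.primeSet A,
          (Solenoid.part (h i) S).ncard ∣ Solenoid.zeroMult p (h i) ∧
          (Solenoid.zeroMult p (h i) : ℚ) / (Solenoid.part (h i) S).ncard
            = (Solenoid.zeroMult p A.charpoly : ℚ) / Solenoid.weight h α S) ∧
    -- the assertions for `B`
    (Solenoid.weight r β S' ∣ n ∧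
      (∀ p ∈ Solenoid.primeSet B, Solenoid.weight r β S' ∣ Solenoid.zeroMult p B.charpoly) ∧
      ∀ j,
        (Solenoid.part (r j) S').ncard ∣ Solenoid.numRoots K (r j) ∧
        (Solenoid.numRoots K (r j) : ℚ) / (Solenoid.part (r j) S').ncard
          = (n : ℚ) / Solenoid.weight r β S' ∧
        ∀ p ∈ Solenoid.primeSet B,
          (Solenoid.part (r j) S').ncard ∣ Solenoid.zeroMult p (r j) ∧
          (Solenoid.zeroMult p (r j) : ℚ) / (Solenoid.part (r j) S').ncard
            = (Solenoid.zeroMult p B.charpoly : ℚ) / Solenoid.weight r β S') := by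
  have hmin := hS.minimalPair hSS'
  have hcov := hmin.iUnion_image_eq hA hB hAK hT
  -- The translates of `S'` correspond to those of `S`, whose union is the whole spectrum of `A`,
  -- and this corresponds only to the whole spectrum of `B`.
  have hcov' : ⋃ σ : K ≃ₐ[ℚ] K, σ '' S' = Solenoid.eigenvalueSet K B := by
    have h1 := Solenoid.Corresponds.iUnion fun σ : K ≃ₐ[ℚ] K => hSS'.image σ
    rw [hcov] at h1
    exact h1.right_unique (Solenoid.corresponds_eigenvalueSet hAK hBK)
  -- Proved for every prime, because the equality of the prime sets is deduced from it.
  have hzero : ∀ p : ℕ, p.Prime →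
      Solenoid.zeroMult p A.charpoly = Solenoid.zeroMult p B.charpoly := by
    intro p hp
    obtain ⟨P, hP⟩ := Solenoid.exists_heightOneSpectrum_mem K hp
    rw [hfac.zeroMult_charpoly_eq_finrank hAK hp P hP,
      rfac.zeroMult_charpoly_eq_finrank hBK hp P hP,
      (hT.1.corresponds_prime hA hB hAK hBK P).finrank_eq]
  have hset : Solenoid.primeSet A = Solenoid.primeSet B := by
    ext p
    rw [Solenoid.mem_primeSet_iff, Solenoid.mem_primeSet_iff]
    exact and_congr_right fun hp => by rw [hzero p hp]
  obtain ⟨hA1, hA2⟩ := hmin.divisibility hA hB hAK hBK hfac hT.1 hcov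
  obtain ⟨hB1, hB2⟩ := hmin.symm.divisibility hB hA hBK hAK rfac hT.1.symm hcov'
  refine ⟨hA1, hB1, ?_, hset, fun p hp => hzero p hp.1, hA2, hB2⟩
  rw [hfac.weight_eq_finrank hSS'.1, rfac.weight_eq_finrank hSS'.2.1, hSS'.finrank_eq]
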